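/- Let $X$ be a proper CAT(0) space (a proper geodesic metric space whose geodesic triangles are at least as thin as Euclidean triangles with the same side lengths), with base-point $o$, and write $\|x\|=d(o,x)$. **Definitions.** A *sublinear function* is a monotone increasing, concave function $\kappa:[0,\infty)\to[1,\infty)$ with $\lim_{t\to\infty}\kappa(t)/t=0$. For $q\ge 1$, $Q\ge 0$, a *$(q,Q)$-quasi-geodesic ray* is a continuous map $\beta:[0,\infty)\to X$ with $\beta(0)=o$ and $\frac1q|s-t|-Q\le d(\beta(s),\beta(t))\le q|s-t|+Q$ for all $s,t$; a *geodesic ray* is an isometric embedding $[0,\infty)\to X$ starting at $o$. Rays are identified with their images where convenient. For a closed set $Z\subseteq X$ let $\mathcal N_\kappa(Z,n)=\{x: d(x,Z)\le n\,\kappa(\|x\|)\}$. Two quasi-geodesic rays *$\kappa$-fellow travel* if each lies in $\mathcal N_\kappa(\cdot,n)$ of the other for some $n$. Let $x_Z$ be the set of points of $Z$ nearest to $x$; $Z$ is *$\kappa$-contracting* if there is a constant $c$ such that $d(x,y)\le d(x,Z)$ implies $\operatorname{diam}(x_Z\cup y_Z)\le c\,\kappa(\|x\|)$. The *$\kappa$-Morse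 boundary* $\partial_\kappa X$ is the set of $\kappa$-fellow traveling classes of $\kappa$-contracting quasi-geodesic rays. For a quasi-geodesic ray $\alpha$ and $r>0$ let $t_r$ be the first time with $\|\alpha(t_r)\|=r$, and put $\alpha_r=\alpha(t_r)$, $\alpha|_r=\alpha([0,t_r])$. A number $D$ is *small compared to* $r>0$ (with respect to $\kappa$) if $D\le \frac{r}{2\kappa(r)}$. A *$\kappa$-Morse gauge* of a geodesic ray $b$ is a function $m$ with $m(q,Q)\ge\max(q,Q)$ such that for all $r,n>0$ and every sublinear function $\kappa''$ there is $R>0$ with the following property: for every $(q,Q)$-quasi-geodesic ray $\eta$ with $m(q,Q)$ small compared to $r$, if $d(\eta_R,b)\le n\,\kappa''(R)$, then $\eta|_r\subseteq\mathcal N_\kappa(b,m(q,Q))$. For $\mathbf b\in\partial_\kappa X$ with geodesic ray $b\in\mathbf b$ and $\kappa$-Morse gauge $m$ of $b$, let $\mathcal U_\kappa(\mathbf b,r)$ be the set of $\mathbf a\in\partial_\kappa X$ such that $\alpha|_r\subseteq\mathcal N_\kappa(b,m(q,Q))$ for every $(q,Q)$-quasi-geodesic ray $\alpha\in\mathbf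 a$ with $m(q,Q)$ small compared to $r$. A set $W\subseteq\partial_\kappa X$ is *open* if for every $\mathbf b\in W$, every geodesic ray $b\in\mathbf b$ and every $\kappa$-Morse gauge $m$ of $b$ there is $r>0$ with $\mathcal U_\kappa(\mathbf b,r)\subseteq W$. **Proposition.** Let $\kappa,\kappa'$ be sublinear functions such that, for some $M>0$, $\kappa'(t)\le M\,\kappa(t)$ for all $t>0$. Then $\partial_{\kappa'}X\subseteq\partial_\kappa X$, and the topology of $\partial_{\kappa'}X$ is the subspace topology induced from $\partial_\kappa X$. -/

import Mathlib

open Set Filter Topology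
open scoped NNReal

namespace SublinearlyMorse

/-! ### CAT(0) spaces -/

/-- `γ` restricted to `[0, d(p,q)]` is a geodesic segment from `p` to `q`. -/
def IsGeodesicSegment {X : Type*} [MetricSpace X] (γ : ℝ → X) (p q : X) : Prop :=
  γ 0 = p ∧ γ (dist p q) = q ∧
    ∀ s ∈ Icc 0 (dist p q), ∀ t ∈ Icc 0 (dist p q), dist (γ s) (γ t) = |s - t|

/-- A CAT(0) space: a geodesic metric space in which, for every geodesic triangle `p q r` and every
comparison triangle `p' q' r'` in the Euclidean plane, points `x ∈ [p,q]`, `y ∈ [p,r]` are at most as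
far apart as their comparison points `x' ∈ [p',q']`, `y' ∈ [p',r']`. -/
structure IsCAT0 (X : Type*) [MetricSpace X] : Prop where
  geodesic : ∀ p q : X, ∃ γ : ℝ → X, IsGeodesicSegment γ p q
  comparison : ∀ (p q r : X) (γ δ : ℝ → X), IsGeodesicSegment γ p q → IsGeodesicSegment δ p r →
    ∀ p' q' r' : EuclideanSpace ℝ (Fin 2),
      dist p' q' = dist p q → dist p' r' = dist p r → dist q' r' = dist q r →
    ∀ s ∈ Icc 0 (dist p q), ∀ t ∈ Icc 0 (dist p r),
    ∀ x' ∈ segment ℝ p' q', ∀ y' ∈ segment ℝ p' r',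
      dist p' x' = dist p (γ s) → dist p' y' = dist p (δ t) →
      dist (γ s) (δ t) ≤ dist x' y'

/-! ### Sublinear functions -/

/-- A sublinear function `κ : [0,∞) → [1,∞)`: monotone, concave, with `κ(t)/t → 0`.
Only the values on `[0,∞)` matter. -/
structure SublinearFunction where
  toFun : ℝ → ℝ
  one_le : ∀ t, 0 ≤ t → 1 ≤ toFun t
  monotoneOn : MonotoneOn toFun (Ici 0)
  concaveOn : ConcaveOn ℝ (Ici 0) toFun
  sublinear : Tendsto (fun t => toFun t / t) atTop (𝓝 0)

instance : CoeFun SublinearFunction (fun _ => ℝ → ℝ) := ⟨SublinearFunction.toFun⟩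

/-- `D` is small compared to the radius `r`. -/
def SmallComparedTo (κ : SublinearFunction) (D r : ℝ) : Prop := D ≤ r / (2 * κ r)

/-! ### Quasi-geodesic rays, neighbourhoods, fellow traveling

Throughout, `o` is the base-point and the norm of `x` is `dist o x`. -/

/-- `β` is a `(q,Q)`-quasi-geodesic ray: a continuous `(q,Q)`-quasi-isometric embedding
of `[0,∞)`, starting at the base-point. -/
structure IsQuasiGeodesicRay {X : Type*} [MetricSpace X] (o : X) (q Q : ℝ) (β : ℝ≥0 → X) :
    Prop where
  one_le : 1 ≤ q
  nonneg : 0 ≤ Q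
  continuous : Continuous β
  start : β 0 = o
  lower : ∀ s t, 1 / q * dist s t - Q ≤ dist (β s) (β t)
  upper : ∀ s t, dist (β s) (β t) ≤ q * dist s t + Q

/-- The quasi-geodesic rays of `X` starting at `o`. -/
def QuasiGeodesicRay {X : Type*} [MetricSpace X] (o : X) : Type _ :=
  {β : ℝ≥0 → X // ∃ q Q : ℝ, IsQuasiGeodesicRay o q Q β}

/-- The `(κ,n)`-neighbourhood of `Z`. -/
def kappaNeighborhood {X : Type*} [MetricSpace X] (κ : SublinearFunction) (o : X) (Z : Set X)
    (n : ℝ) : Set X :=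
  {x | Metric.infDist x Z ≤ n * κ (dist o x)}

/-- `β` and `γ` `κ`-fellow travel each other: each (as a subset of `X`) lies in some
`κ`-neighbourhood of the other. -/
def FellowTravel {X : Type*} [MetricSpace X] (κ : SublinearFunction) {o : X}
    (β γ : QuasiGeodesicRay o) : Prop :=
  (∃ n : ℝ, range β.1 ⊆ kappaNeighborhood κ o (range γ.1) n) ∧
    ∃ n : ℝ, range γ.1 ⊆ kappaNeighborhood κ o (range β.1) n

/-- The class of `β` under `κ`-fellow traveling. -/
def fellowClass {X : Type*} [MetricSpace X] (κ : SublinearFunction) {o : X}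
    (β : QuasiGeodesicRay o) : Set (QuasiGeodesicRay o) :=
  {γ | FellowTravel κ β γ}

/-- The set of nearest points to `x` in `Z`. -/
def nearestPoints {X : Type*} [MetricSpace X] (Z : Set X) (x : X) : Set X :=
  {z | z ∈ Z ∧ dist x z = Metric.infDist x Z}

/-- `Z` is `κ`-contracting: there is `c` such that `d(x,y) ≤ d(x,Z)` implies that
`x_Z ∪ y_Z` has diameter at most `c κ(‖x‖)`. -/
def IsContracting {X : Type*} [MetricSpace X] (κ : SublinearFunction) (o : X) (Z : Set X) : Prop :=
  ∃ c : ℝ, ∀ x y : X, dist x y ≤ Metric.infDist x Z →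
    ∀ u ∈ nearestPoints Z x ∪ nearestPoints Z y, ∀ v ∈ nearestPoints Z x ∪ nearestPoints Z y,
      dist u v ≤ c * κ (dist o x)

/-- The `κ`-Morse boundary: the set of `κ`-fellow traveling classes of `κ`-contracting
quasi-geodesic rays. -/
def morseBoundary {X : Type*} [MetricSpace X] (κ : SublinearFunction) (o : X) :
    Set (Set (QuasiGeodesicRay o)) :=
  {B | ∃ β : QuasiGeodesicRay o, IsContracting κ o (range β.1) ∧ B = fellowClass κ β}

/-! ### The topology of the boundary -/

/-- The first time at which `β` has norm `r`. -/
noncomputable def firstTime {X : Type*} [MetricSpace X] (o : X) (β : ℝ≥0 → X) (r : ℝ) : ℝ≥0 :=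
  sInf {t | dist o (β t) = r}

/-- The initial part `β|_r = β[0, t_r]`, as a subset of `X`. -/
noncomputable def initialPart {X : Type*} [MetricSpace X] (o : X) (β : ℝ≥0 → X) (r : ℝ) : Set X :=
  β '' Iic (firstTime o β r)

/-- `m` is a (strong) `κ`-Morse gauge for `Z`: `m(q,Q) ≥ max(q,Q)`, and for all `r, n > 0` and every
sublinear `κ''` there is a radius `R > 0` such that every `(q,Q)`-quasi-geodesic ray `η` with
`m(q,Q)` small compared to `r` and `d(η(t_R), Z) ≤ n κ''(R)` satisfies
`η[0,t_r] ⊆ N_κ(Z, m(q,Q))`. -/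
def IsMorseGauge {X : Type*} [MetricSpace X] (κ : SublinearFunction) (o : X) (Z : Set X)
    (m : ℝ → ℝ → ℝ) : Prop :=
  (∀ q Q : ℝ, 1 ≤ q → 0 ≤ Q → max q Q ≤ m q Q) ∧
  ∀ r : ℝ, 0 < r → ∀ n : ℝ, 0 < n → ∀ κ'' : SublinearFunction, ∃ R : ℝ, 0 < R ∧
    ∀ (q Q : ℝ) (η : ℝ≥0 → X), IsQuasiGeodesicRay o q Q η → SmallComparedTo κ (m q Q) r →
      Metric.infDist (η (firstTime o η R)) Z ≤ n * κ'' R →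
      initialPart o η r ⊆ kappaNeighborhood κ o Z (m q Q)

/-- The set `U_κ(b, r)`, for `b` a geodesic ray with Morse gauge `m`: all points `A` of the boundary
such that every `(q,Q)`-quasi-geodesic `α ∈ A` with `m(q,Q)` small compared to `r` satisfies
`α|_r ⊆ N_κ(b, m(q,Q))`. -/
def basicNeighborhood {X : Type*} [MetricSpace X] (κ : SublinearFunction) (o : X) (b : ℝ≥0 → X)
    (m : ℝ → ℝ → ℝ) (r : ℝ) : Set (morseBoundary κ o) :=
  {A | ∀ α ∈ A.1, ∀ q Q : ℝ, IsQuasiGeodesicRay o q Q α.1 → SmallComparedTo κ (m q Q) r →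
    initialPart o α.1 r ⊆ kappaNeighborhood κ o (range b) (m q Q)}

theorem SmallComparedTo.mono {κ : SublinearFunction} {D r r' : ℝ} (hr : 0 < r) (hrr : r ≤ r')
    (h : SmallComparedTo κ D r) : SmallComparedTo κ D r' := by
  have hr' : 0 < r' := hr.trans_le hrr
  have h1 := κ.one_le r hr.le
  have h2 := κ.one_le r' hr'.le
  have h0 := κ.one_le 0 le_rfl
  have hc := κ.concaveOn.2 (show (0 : ℝ) ∈ Ici 0 by simp) (show r' ∈ Ici 0 from hr'.le)
    (show (0 : ℝ) ≤ 1 - r / r' by rw [sub_nonneg, div_le_one hr']; exact hrr)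
    (show (0 : ℝ) ≤ r / r' by positivity) (by ring)
  have he : (1 - r / r') • (0 : ℝ) + (r / r') • r' = r := by
    simp only [smul_eq_mul]; field_simp; ring
  rw [he] at hc
  simp only [smul_eq_mul] at hc
  have hle : r / r' ≤ 1 := by rw [div_le_one hr']; exact hrr
  have hk : r / r' * κ r' ≤ κ r := by nlinarith
  refine le_trans h ?_
  rw [div_le_div_iff₀ (by positivity) (by positivity)]
  have : r * κ r' ≤ κ r * r' := by
    have := mul_le_mul_of_nonneg_right hk hr'.le
    calc r * κ r' = r / r' * κ r' * r' := by field_simp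
      _ ≤ _ := this
  nlinarith

theorem firstTime_mono {X : Type*} [MetricSpace X] {o : X} {q Q : ℝ} {β : ℝ≥0 → X}
    (hβ : IsQuasiGeodesicRay o q Q β) {r r' : ℝ} (hr : 0 ≤ r) (hrr : r ≤ r') :
    firstTime o β r ≤ firstTime o β r' := by
  have hq : 0 < q := lt_of_lt_of_le one_pos hβ.one_le
  have hc : Continuous fun t => dist o (β t) := continuous_const.dist hβ.continuous
  have h0 : dist o (β 0) = 0 := by rw [hβ.start, dist_self]
  have hr' : 0 ≤ r' := hr.trans hrr
  have hne : {t | dist o (β t) = r'}.Nonempty := by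
    have hT : 0 ≤ q * (r' + Q) := mul_nonneg hq.le (add_nonneg hr' hβ.nonneg)
    obtain ⟨T, hTT⟩ : ∃ T : ℝ≥0, (T : ℝ) = q * (r' + Q) := ⟨⟨_, hT⟩, rfl⟩
    have hl := hβ.lower 0 T
    rw [NNReal.dist_eq, hβ.start, NNReal.coe_zero, zero_sub, abs_neg, hTT, abs_of_nonneg hT] at hl
    have hl' : r' ≤ dist o (β T) := by
      have : 1 / q * (q * (r' + Q)) = r' + Q := by field_simp
      linarith
    obtain ⟨t, -, ht⟩ := intermediate_value_Icc (zero_le : 0 ≤ T) hc.continuousOn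
      (show r' ∈ Icc (dist o (β 0)) (dist o (β T)) from ⟨by rw [h0]; exact hr', hl'⟩)
    exact ⟨t, ht⟩
  have hmem : dist o (β (firstTime o β r')) = r' :=
    (isClosed_eq hc continuous_const).csInf_mem hne (OrderBot.bddBelow _)
  obtain ⟨t, ht, ht'⟩ := intermediate_value_Icc (zero_le : 0 ≤ firstTime o β r') hc.continuousOn
    (show r ∈ Icc (dist o (β 0)) (dist o (β (firstTime o β r'))) from
      ⟨by rw [h0]; exact hr, by rw [hmem]; exact hrr⟩)
  have hs : firstTime o β r ≤ t := csInf_le (OrderBot.bddBelow {t | dist o (β t) = r}) ht'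
  exact hs.trans ht.2

theorem basicNeighborhood_anti {X : Type*} [MetricSpace X] (κ : SublinearFunction) (o : X)
    (b : ℝ≥0 → X) (m : ℝ → ℝ → ℝ) {r r' : ℝ} (hr : 0 < r) (hrr : r ≤ r') :
    basicNeighborhood κ o b m r' ⊆ basicNeighborhood κ o b m r := by
  intro A hA α hα q Q hq hs
  refine Subset.trans ?_ (hA α hα q Q hq (hs.mono hr hrr))
  exact image_mono (Iic_subset_Iic.2 (firstTime_mono hq hr.le hrr))

/-- The visual topology on quasi-geodesics: `W` is open iff for every class `B ∈ W`, with its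
geodesic ray `b` and a Morse gauge `m` of `b`, some `U_κ(b, r)` with `r > 0` lies in `W`. -/
@[reducible] def visualTopology {X : Type*} [MetricSpace X] (κ : SublinearFunction) (o : X) :
    TopologicalSpace (morseBoundary κ o) where
  IsOpen W := ∀ B ∈ W, ∀ b ∈ B.1, Isometry b.1 → ∀ m : ℝ → ℝ → ℝ, IsMorseGauge κ o (range b.1) m →
    ∃ r : ℝ, 0 < r ∧ basicNeighborhood κ o b.1 m r ⊆ W
  isOpen_univ := fun _ _ _ _ _ _ _ => ⟨1, one_pos, subset_univ _⟩
  isOpen_inter := fun U V hU hV B hB b hb hi m hm => by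
    obtain ⟨r, hr, h⟩ := hU B hB.1 b hb hi m hm
    obtain ⟨r', hr', h'⟩ := hV B hB.2 b hb hi m hm
    exact ⟨max r r', lt_max_of_lt_left hr, subset_inter
      ((basicNeighborhood_anti κ o b.1 m hr (le_max_left _ _)).trans h)
      ((basicNeighborhood_anti κ o b.1 m hr' (le_max_right _ _)).trans h')⟩
  isOpen_sUnion := fun S hS B ⟨U, hU, hB⟩ b hb hi m hm => by
    obtain ⟨r, hr, h⟩ := hS U hU B hB b hb hi m hm
    exact ⟨r, hr, h.trans (subset_sUnion_of_mem hU)⟩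

end SublinearlyMorse

open SublinearlyMorse

namespace SublinearlyMorse

/-! ### Growth of sublinear functions -/

/-! The engine is the strong Morse property: a contracting ray has a Morse gauge
(`IsContracting.exists_isMorseGauge`). A quasi-geodesic outside a neighbourhood of a contracting set
has a slowly moving projection, so long excursions are impossible. Hence being close at one large
radius, measured by any sublinear function, forces `κ`-closeness on a fixed initial part.

Inclusion: `κ'`-contracting implies `κ`-contracting. Applying the `κ'`-gauge with `κ` in the role of
`κ''` upgrades `κ`-fellow traveling to `κ'`-fellow traveling, so the two classes of a
`κ'`-contracting ray are the same set of rays.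

Topology: if `m'` is a `κ'`-gauge, then `M * m'` is a `κ`-gauge of the same ray. Smallness at `r`
bounds the quasi-geodesic constants by a number depending only on `r`, so one radius `R` serves all
rays concerned, and the basic neighbourhoods for `κ` and `κ'` are nested in each other
(`IsMorseGauge.exists_initialPart_subset`).

Basic neighbourhoods need not be open, so a `κ'`-open set must still be extended to a `κ`-open one.
This needs every class near `b` to have a whole basic neighbourhood near `b`
(`IsMorseGauge.exists_basicNeighborhood_subset`). The tool is surgery: a ray `α` that is close to a
geodesic ray `a` for long is rerouted onto `a`, and what is known about the class of `a` then
controls the unchanged beginning of `α`. -/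

theorem SublinearFunction.pos (κ : SublinearFunction) {t : ℝ} (ht : 0 ≤ t) : 0 < κ t :=
  one_pos.trans_le (κ.one_le t ht)

/-- Concavity and `κ 0 ≥ 0` make `κ t / t` nonincreasing; subadditivity follows. -/
theorem SublinearFunction.mul_le_mul (κ : SublinearFunction) {s t : ℝ} (hs : 0 ≤ s) (hst : s ≤ t) :
    s * κ t ≤ t * κ s := by
  rcases hs.eq_or_lt with rfl | hs'
  · have := κ.pos le_rfl
    rw [zero_mul]
    positivity
  have ht : 0 < t := hs'.trans_le hst
  have h0 := κ.one_le 0 le_rfl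
  have hle : s / t ≤ 1 := (div_le_one ht).2 hst
  have hc := κ.concaveOn.2 (show (0 : ℝ) ∈ Ici 0 by simp) (show t ∈ Ici 0 from ht.le)
    (show (0 : ℝ) ≤ 1 - s / t by linarith) (show (0 : ℝ) ≤ s / t by positivity) (by ring)
  have he : (1 - s / t) • (0 : ℝ) + (s / t) • t = s := by
    simp only [smul_eq_mul]; field_simp; ring
  rw [he] at hc
  simp only [smul_eq_mul] at hc
  have hk : s / t * κ t ≤ κ s := by nlinarith
  calc s * κ t = t * (s / t * κ t) := by field_simp
    _ ≤ t * κ s := mul_le_mul_of_nonneg_left hk ht.le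

theorem SublinearFunction.map_add_le (κ : SublinearFunction) {s t : ℝ} (hs : 0 ≤ s) (ht : 0 ≤ t) :
    κ (s + t) ≤ κ s + κ t := by
  rcases (add_nonneg hs ht).eq_or_lt with h | h
  · obtain rfl : s = 0 := by linarith
    obtain rfl : t = 0 := by linarith
    have := κ.pos le_rfl
    simp only [add_zero]
    linarith
  · have h1 := κ.mul_le_mul hs (le_add_of_nonneg_right ht)
    have h2 := κ.mul_le_mul ht (le_add_of_nonneg_left hs)
    refine le_of_mul_le_mul_left ?_ h
    linarith

theorem SublinearFunction.mono (κ : SublinearFunction) {s t : ℝ} (hs : 0 ≤ s) (hst : s ≤ t) :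
    κ s ≤ κ t := κ.monotoneOn hs (hs.trans hst) hst

theorem SublinearFunction.eventually_le (κ : SublinearFunction) {ε : ℝ} (hε : 0 < ε) :
    ∀ᶠ u in atTop, κ u ≤ ε * u := by
  filter_upwards [κ.sublinear.eventually (gt_mem_nhds hε), eventually_gt_atTop 0] with u hu h0
  exact ((div_lt_iff₀ h0).1 hu).le

/-- Used to absorb: when `κ` is evaluated at an error term, a small `ε` lets that term be moved to
the other side. -/
theorem SublinearFunction.exists_le_mul_add (κ : SublinearFunction) {ε : ℝ} (hε : 0 < ε) :
    ∃ C, 0 ≤ C ∧ ∀ u, 0 ≤ u → κ u ≤ ε * u + C := by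
  obtain ⟨A, hA⟩ := ((κ.eventually_le hε).and (eventually_ge_atTop 0)).exists_forall_of_atTop
  have hA0 := (hA A le_rfl).2
  refine ⟨κ A, (κ.pos hA0).le, fun u hu => ?_⟩
  rcases le_total A u with h | h
  · linarith [(hA u h).1, κ.pos hA0]
  · nlinarith [κ.mono hu h]

theorem SublinearFunction.map_max_one_le (κ : SublinearFunction) {t : ℝ} (ht : 0 ≤ t) :
    κ (max t 1) ≤ κ 1 * κ t := by
  have h1 := κ.one_le 1 zero_le_one
  have h2 := κ.one_le t ht
  rcases le_total t 1 with h | h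
  · rw [max_eq_right h]; nlinarith
  · rw [max_eq_left h]; nlinarith

/-- A concave function may jump at `0`. Cutting off at `1` restores continuity for the intermediate
value arguments, at the cost of a factor `κ 1`. -/
theorem SublinearFunction.continuous_map_max_one (κ : SublinearFunction) :
    Continuous fun t : ℝ => κ (max t 1) := by
  have h : ContinuousOn κ.toFun (Ioi 0) :=
    (κ.concaveOn.subset Ioi_subset_Ici_self (convex_Ioi 0)).continuousOn isOpen_Ioi
  exact h.comp_continuous (continuous_id.max continuous_const)
    fun t => one_pos.trans_le (le_max_right t 1)

instance : Add SublinearFunction where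
  add κ κ' :=
    { toFun := fun t => κ t + κ' t
      one_le := fun t ht => by linarith [κ.one_le t ht, κ'.one_le t ht]
      monotoneOn := κ.monotoneOn.add κ'.monotoneOn
      concaveOn := κ.concaveOn.add κ'.concaveOn
      sublinear := by simpa [add_div] using κ.sublinear.add κ'.sublinear }

theorem SublinearFunction.add_apply (κ κ' : SublinearFunction) (t : ℝ) :
    (κ + κ') t = κ t + κ' t := rfl

theorem eventually_smallComparedTo (κ : SublinearFunction) (D : ℝ) :
    ∀ᶠ r in atTop, SmallComparedTo κ D r := by
  have hε : (0 : ℝ) < 1 / (2 * (|D| + 1)) := by positivity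
  filter_upwards [κ.eventually_le hε, eventually_gt_atTop 0] with r hr h0
  have hk := κ.pos h0.le
  rw [SmallComparedTo, le_div_iff₀ (by positivity)]
  rw [div_mul_eq_mul_div, one_mul, le_div_iff₀ (by positivity)] at hr
  nlinarith [le_abs_self D]

/-! ### Neighbourhoods -/

section Neighborhoods

variable {X : Type*} [MetricSpace X] {o : X}

theorem kappaNeighborhood_mono (κ : SublinearFunction) {Z : Set X} {n n' : ℝ} (h : n ≤ n') :
    kappaNeighborhood κ o Z n ⊆ kappaNeighborhood κ o Z n' := fun _ hx =>
  le_trans hx (mul_le_mul_of_nonneg_right h (κ.pos dist_nonneg).le)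

/-- `D` is kept independent of `κ` because it will also be `n * κ'' R` for an unrelated `κ''`. The
extra `1` pays for an infimum that need not be attained. -/
theorem infDist_le_trans (κ : SublinearFunction) {n : ℝ} (hn : 0 ≤ n) : ∃ C, 0 ≤ C ∧
    ∀ (x : X) (D : ℝ) (Y Z : Set X), 0 ≤ D → Y.Nonempty → Y ⊆ kappaNeighborhood κ o Z n →
      Metric.infDist x Y ≤ D → Metric.infDist x Z ≤ D + 1 + n * (κ (dist o x) + D + C) := by
  obtain ⟨C, hC, h⟩ := κ.exists_le_mul_add one_pos
  refine ⟨C + 1, by positivity, fun x D Y Z hD hY hYZ hx => ?_⟩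
  obtain ⟨y, hy, hxy⟩ := (Metric.infDist_lt_iff hY).1 (lt_of_le_of_lt hx (lt_add_one D))
  have h1 : Metric.infDist y Z ≤ n * κ (dist o y) := hYZ hy
  have h2 : κ (dist o y) ≤ κ (dist o x) + D + (C + 1) := by
    have h3 : dist o y ≤ dist o x + (D + 1) := by linarith [dist_triangle o x y]
    have h4 := κ.mono dist_nonneg h3
    have h5 := κ.map_add_le (dist_nonneg (x := o) (y := x)) (by positivity : 0 ≤ D + 1)
    linarith [h (D + 1) (by positivity)]
  linarith [Metric.infDist_le_infDist_add_dist (s := Z) (x := x) (y := y),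
    mul_le_mul_of_nonneg_left h2 hn]

theorem kappaNeighborhood_comp (κ : SublinearFunction) {n n' : ℝ} (hn : 0 ≤ n) (hn' : 0 ≤ n') :
    ∃ N, 0 ≤ N ∧ ∀ Y Z : Set X, Y.Nonempty → Y ⊆ kappaNeighborhood κ o Z n' →
      kappaNeighborhood κ o Y n ⊆ kappaNeighborhood κ o Z N := by
  obtain ⟨C, hC, h⟩ := infDist_le_trans (o := o) κ hn'
  refine ⟨n + 1 + n' * (1 + n + C), by positivity, fun Y Z hY hYZ x hx => ?_⟩
  have hk := κ.one_le (dist o x) dist_nonneg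
  refine (h x _ Y Z (by positivity) hY hYZ hx).trans ?_
  have : n' * (κ (dist o x) + n * κ (dist o x) + C) ≤ n' * ((1 + n + C) * κ (dist o x)) :=
    mul_le_mul_of_nonneg_left (by nlinarith) hn'
  nlinarith

theorem FellowTravel.symm {κ : SublinearFunction} {β γ : QuasiGeodesicRay o}
    (h : FellowTravel κ β γ) : FellowTravel κ γ β := ⟨h.2, h.1⟩

theorem exists_subset_kappaNeighborhood_trans {κ : SublinearFunction} {Y Z W : Set X}
    (hZ : Z.Nonempty) (h : ∃ n, Y ⊆ kappaNeighborhood κ o Z n)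
    (h' : ∃ n, Z ⊆ kappaNeighborhood κ o W n) : ∃ n, Y ⊆ kappaNeighborhood κ o W n := by
  obtain ⟨n, hn⟩ := h
  obtain ⟨n', hn'⟩ := h'
  obtain ⟨N, -, hN⟩ := kappaNeighborhood_comp (o := o) κ (le_max_right n 0) (le_max_right n' 0)
  exact ⟨N, (hn.trans (kappaNeighborhood_mono κ (le_max_left n 0))).trans
    (hN Z W hZ (hn'.trans (kappaNeighborhood_mono κ (le_max_left n' 0))))⟩

theorem FellowTravel.trans {κ : SublinearFunction} {β γ ζ : QuasiGeodesicRay o}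
    (h : FellowTravel κ β γ) (h' : FellowTravel κ γ ζ) : FellowTravel κ β ζ :=
  ⟨exists_subset_kappaNeighborhood_trans (range_nonempty _) h.1 h'.1,
    exists_subset_kappaNeighborhood_trans (range_nonempty _) h'.2 h.2⟩

theorem kappaNeighborhood_subset {κ κ' : SublinearFunction} {M n : ℝ} (hn : 0 ≤ n)
    (h : ∀ t, 0 ≤ t → κ' t ≤ M * κ t) (Z : Set X) :
    kappaNeighborhood κ' o Z n ⊆ kappaNeighborhood κ o Z (M * n) := fun x hx => by
  refine (le_trans hx (mul_le_mul_of_nonneg_left (h (dist o x) dist_nonneg) hn)).trans_eq ?_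
  ring

theorem FellowTravel.of_le {κ κ' : SublinearFunction} {M : ℝ} (h : ∀ t, 0 ≤ t → κ' t ≤ M * κ t)
    {β γ : QuasiGeodesicRay o} (hβ : FellowTravel κ' β γ) : FellowTravel κ β γ := by
  obtain ⟨⟨n, hn⟩, n', hn'⟩ := hβ
  exact ⟨⟨_, (hn.trans (kappaNeighborhood_mono κ' (le_max_left n 0))).trans
      (kappaNeighborhood_subset (le_max_right n 0) h _)⟩,
    ⟨_, (hn'.trans (kappaNeighborhood_mono κ' (le_max_left n' 0))).trans
      (kappaNeighborhood_subset (le_max_right n' 0) h _)⟩⟩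

end Neighborhoods

/-! ### Quasi-geodesic rays -/

section Rays

variable {X : Type*} [MetricSpace X] {o : X} {q Q : ℝ} {β : ℝ≥0 → X}

theorem IsQuasiGeodesicRay.mono (h : IsQuasiGeodesicRay o q Q β) {q' Q' : ℝ} (hq : q ≤ q')
    (hQ : Q ≤ Q') : IsQuasiGeodesicRay o q' Q' β where
  one_le := h.one_le.trans hq
  nonneg := h.nonneg.trans hQ
  continuous := h.continuous
  start := h.start
  lower s t := by
    have h1 : 1 / q' * dist s t ≤ 1 / q * dist s t :=
      mul_le_mul_of_nonneg_right
        (one_div_le_one_div_of_le (one_pos.trans_le h.one_le) hq) dist_nonneg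
    linarith [h.lower s t]
  upper s t := by
    have h1 : q * dist s t ≤ q' * dist s t := mul_le_mul_of_nonneg_right hq dist_nonneg
    linarith [h.upper s t]

theorem IsQuasiGeodesicRay.of_isometry (h : Isometry β) (h0 : β 0 = o) :
    IsQuasiGeodesicRay o 1 0 β where
  one_le := le_rfl
  nonneg := le_rfl
  continuous := h.continuous
  start := h0
  lower s t := by simp [h.dist_eq]
  upper s t := by simp [h.dist_eq]

theorem QuasiGeodesicRay.start (β : QuasiGeodesicRay o) : β.1 0 = o :=
  let ⟨_, _, h⟩ := β.2
  h.start

theorem dist_isometry {a : ℝ≥0 → X} (h : Isometry a) (h0 : a 0 = o) (t : ℝ≥0) :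
    dist o (a t) = t := by
  rw [← h0, h.dist_eq, NNReal.dist_eq]
  simp

theorem IsQuasiGeodesicRay.dist_le_mul (h : IsQuasiGeodesicRay o q Q β) (s t : ℝ≥0) :
    dist s t ≤ q * (dist (β s) (β t) + Q) := by
  have hq := one_pos.trans_le h.one_le
  have h1 := h.lower s t
  rw [sub_le_iff_le_add, div_mul_eq_mul_div, one_mul, div_le_iff₀ hq] at h1
  linarith

theorem IsQuasiGeodesicRay.coe_le_mul (h : IsQuasiGeodesicRay o q Q β) (t : ℝ≥0) :
    (t : ℝ) ≤ q * (dist o (β t) + Q) := by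
  have := h.dist_le_mul 0 t
  rwa [h.start, NNReal.dist_eq, NNReal.coe_zero, zero_sub, abs_neg, abs_of_nonneg t.coe_nonneg] at this

theorem IsQuasiGeodesicRay.tendsto_dist (h : IsQuasiGeodesicRay o q Q β) :
    Tendsto (fun t => dist o (β t)) atTop atTop := by
  have hq := one_pos.trans_le h.one_le
  have h1 : Tendsto (fun t : ℝ≥0 => (t : ℝ) / q - Q) atTop atTop :=
    tendsto_atTop_add_const_right _ _
      ((NNReal.tendsto_coe_atTop.2 tendsto_id).atTop_div_const hq)
  refine tendsto_atTop_mono (fun t => ?_) h1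
  rw [sub_le_iff_le_add, div_le_iff₀ hq, mul_comm]
  exact h.coe_le_mul t

theorem IsQuasiGeodesicRay.dist_firstTime (h : IsQuasiGeodesicRay o q Q β) {r : ℝ} (hr : 0 ≤ r) :
    dist o (β (firstTime o β r)) = r := by
  have hc : Continuous fun t => dist o (β t) := continuous_const.dist h.continuous
  obtain ⟨T, hT⟩ := (h.tendsto_dist.eventually_ge_atTop r).exists
  obtain ⟨t, -, ht⟩ := intermediate_value_Icc (zero_le : 0 ≤ T) hc.continuousOn
    (show r ∈ Icc (dist o (β 0)) (dist o (β T)) from ⟨by rwa [h.start, dist_self], hT⟩)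
  exact (isClosed_eq hc continuous_const).csInf_mem ⟨t, ht⟩ (OrderBot.bddBelow _)

theorem IsQuasiGeodesicRay.dist_le_of_le_firstTime (h : IsQuasiGeodesicRay o q Q β) {r : ℝ}
    (hr : 0 ≤ r) {t : ℝ≥0} (ht : t ≤ firstTime o β r) : dist o (β t) ≤ r := by
  by_contra! hlt
  have hc : Continuous fun t => dist o (β t) := continuous_const.dist h.continuous
  obtain ⟨s, hs, hsr⟩ := intermediate_value_Icc (zero_le : 0 ≤ t) hc.continuousOn
    (show r ∈ Icc (dist o (β 0)) (dist o (β t)) from ⟨by rwa [h.start, dist_self], hlt.le⟩)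
  have h1 : firstTime o β r ≤ s := csInf_le (OrderBot.bddBelow {t | dist o (β t) = r}) hsr
  obtain rfl : s = t := le_antisymm hs.2 (ht.trans h1)
  exact hlt.ne' hsr

theorem IsQuasiGeodesicRay.firstTime_le (h : IsQuasiGeodesicRay o q Q β) {r : ℝ}
    (hr : 0 ≤ r) {t : ℝ≥0} (ht : r ≤ dist o (β t)) : firstTime o β r ≤ t := by
  have hc : Continuous fun t => dist o (β t) := continuous_const.dist h.continuous
  obtain ⟨s, hs, hsr⟩ := intermediate_value_Icc (zero_le : 0 ≤ t) hc.continuousOn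
    (show r ∈ Icc (dist o (β 0)) (dist o (β t)) from ⟨by rwa [h.start, dist_self], ht⟩)
  exact (csInf_le (OrderBot.bddBelow {t | dist o (β t) = r}) hsr).trans hs.2

theorem IsQuasiGeodesicRay.mem_initialPart (h : IsQuasiGeodesicRay o q Q β) {r R : ℝ} (hr : 0 ≤ r)
    (hR : r ≤ R) : β (firstTime o β r) ∈ initialPart o β R :=
  mem_image_of_mem β (firstTime_mono h hr hR)

theorem IsQuasiGeodesicRay.range_subset (h : IsQuasiGeodesicRay o q Q β) {S : Set X}
    (hS : ∀ᶠ r in atTop, initialPart o β r ⊆ S) : range β ⊆ S := by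
  rintro _ ⟨t, rfl⟩
  obtain ⟨r, hr, h1, h0⟩ :=
    (hS.and ((eventually_gt_atTop (q * t + Q)).and (eventually_ge_atTop 0))).exists
  refine hr (mem_image_of_mem β (mem_Iic.2 <| le_of_not_gt fun hlt => ?_))
  have h2 := h.upper 0 (firstTime o β r)
  rw [h.start, h.dist_firstTime h0, NNReal.dist_eq, NNReal.coe_zero, zero_sub, abs_neg,
    abs_of_nonneg (NNReal.coe_nonneg _)] at h2
  have h3 : q * (firstTime o β r : ℝ) ≤ q * t :=
    mul_le_mul_of_nonneg_left (NNReal.coe_le_coe.2 hlt.le) (zero_le_one.trans h.one_le)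
  linarith

/-- The norm tends to infinity along `β`, so `β` is a proper map and images of closed sets are
closed. -/
theorem IsQuasiGeodesicRay.exists_infDist_image_eq [ProperSpace X] (h : IsQuasiGeodesicRay o q Q β)
    {S : Set ℝ≥0} (hS : IsClosed S) (hne : S.Nonempty) (x : X) :
    ∃ t ∈ S, Metric.infDist x (β '' S) = dist x (β t) := by
  have hp : IsProperMap β := by
    refine isProperMap_iff_tendsto_cocompact.2 ⟨h.continuous, ?_⟩
    refine tendsto_cocompact_of_tendsto_dist_comp_atTop o ?_
    simp_rw [dist_comm _ o]
    refine h.tendsto_dist.mono_left ?_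
    exact cocompact_le_atTop
  obtain ⟨_, ⟨t, ht, rfl⟩, hx⟩ := (hp.isClosedMap S hS).exists_infDist_eq_dist (hne.image β) x
  exact ⟨t, ht, hx⟩

end Rays

/-! ### Quasi-geodesics and contracting sets -/

theorem exists_last_zero {g : ℝ → ℝ} {T : ℝ} (hT : 0 ≤ T) (hg : ContinuousOn g (Icc 0 T))
    (h0 : g 0 ≤ 0) (h1 : 0 ≤ g T) : ∃ s ∈ Icc 0 T, g s = 0 ∧ ∀ t ∈ Icc s T, 0 ≤ g t := by
  have hK : IsCompact (Icc 0 T ∩ g ⁻¹' {0}) :=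
    isCompact_Icc.of_isClosed_subset (hg.preimage_isClosed_of_isClosed isClosed_Icc
      isClosed_singleton) inter_subset_left
  obtain ⟨z, hz, hz0⟩ := intermediate_value_Icc hT hg ⟨h0, h1⟩
  obtain ⟨s, ⟨hs, hs0⟩, hmax⟩ := hK.exists_isGreatest ⟨z, hz, hz0⟩
  refine ⟨s, hs, hs0, fun t ht => ?_⟩
  by_contra! hlt
  obtain ⟨w, hw, hw0⟩ := intermediate_value_Icc ht.2
    (hg.mono (Icc_subset_Icc_left (hs.1.trans ht.1))) (show (0 : ℝ) ∈ Icc (g t) (g T) from ⟨hlt.le, h1⟩)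
  have hws : w ≤ s := hmax ⟨⟨(hs.1.trans ht.1).trans hw.1, hw.2⟩, hw0⟩
  obtain rfl : t = s := le_antisymm (hw.1.trans hws) ht.1
  exact hlt.ne hs0

theorem exists_first_zero {g : ℝ → ℝ} {a b : ℝ} (hab : a ≤ b) (hg : ContinuousOn g (Icc a b))
    (h0 : 0 ≤ g a) (h1 : g b ≤ 0) : ∃ s ∈ Icc a b, g s = 0 ∧ ∀ t ∈ Icc a s, 0 ≤ g t := by
  obtain ⟨s, hs, hs0, h⟩ := exists_last_zero (g := fun t => g (b - t)) (T := b - a) (by linarith)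
    (hg.comp (by fun_prop) fun t ht => ⟨by linarith [ht.2], by linarith [ht.1]⟩)
    (by simpa using h1) (by simpa using h0)
  refine ⟨b - s, ⟨by linarith [hs.2], by linarith [hs.1]⟩, hs0, fun t ht => ?_⟩
  have := h (b - t) ⟨by linarith [ht.2], by linarith [ht.1]⟩
  simpa using this

/-- A continuous path on `[0, T]` which is a `(K,K)`-quasi-isometric embedding. -/
structure IsQuasiGeodesicOn {X : Type*} [MetricSpace X] (K T : ℝ) (η : ℝ → X) : Prop where
  continuousOn : ContinuousOn η (Icc 0 T)
  lower : ∀ s t, 0 ≤ s → s ≤ t → t ≤ T → t - s ≤ K * (dist (η s) (η t) + K)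
  upper : ∀ s t, 0 ≤ s → s ≤ t → t ≤ T → dist (η s) (η t) ≤ K * (t - s) + K

variable {X : Type*} [MetricSpace X] {o : X}

theorem IsQuasiGeodesicRay.isQuasiGeodesicOn {q Q : ℝ} {β : ℝ≥0 → X}
    (h : IsQuasiGeodesicRay o q Q β) {K : ℝ} (hq : q ≤ K) (hQ : Q ≤ K) (T : ℝ) :
    IsQuasiGeodesicOn K T fun t => β t.toNNReal := by
  have h' := h.mono hq hQ
  have hd : ∀ s t : ℝ, 0 ≤ s → s ≤ t → dist s.toNNReal t.toNNReal = t - s := fun s t hs hst => by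
    rw [NNReal.dist_eq, Real.coe_toNNReal _ hs, Real.coe_toNNReal _ (hs.trans hst), abs_sub_comm,
      abs_of_nonneg (sub_nonneg.2 hst)]
  refine ⟨(h.continuous.comp continuous_real_toNNReal).continuousOn, fun s t hs hst _ => ?_,
    fun s t hs hst _ => ?_⟩
  · simpa only [hd s t hs hst] using h'.dist_le_mul s.toNNReal t.toNNReal
  · simpa only [hd s t hs hst] using h'.upper s.toNNReal t.toNNReal

/-- Contraction with respect to a weight `f`. -/
def IsWeightContracting (f : X → ℝ) (c : ℝ) (Z : Set X) : Prop :=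
  ∀ x y : X, dist x y ≤ Metric.infDist x Z → ∀ u ∈ nearestPoints Z x, ∀ v ∈ nearestPoints Z y,
    dist u v ≤ c * f x

/-- The path is cut into hops of length `d(η s, Z)`. Each hop moves the projection by at most `c *
f`, a fraction `c / m` of its length; the last, incomplete hop gives the terms without `2 * K`. -/
theorem IsWeightContracting.dist_le {f : X → ℝ} {c : ℝ} {Z : Set X} (hf : ∀ x, 1 ≤ f x)
    (hc : 0 ≤ c) (h : IsWeightContracting f c Z) (hZ : ∀ x, (nearestPoints Z x).Nonempty)
    {K m T : ℝ} {η : ℝ → X} (hη : IsQuasiGeodesicOn K T η) (hK : 1 ≤ K) (hm : 2 * K ≤ m) (N : ℕ) :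
    ∀ s s', 0 ≤ s → s ≤ s' → s' ≤ T → s' - s ≤ N →
      (∀ t ∈ Icc s s', m * f (η t) ≤ Metric.infDist (η t) Z) →
      ∀ u ∈ nearestPoints Z (η s), ∀ v ∈ nearestPoints Z (η s'),
        dist u v ≤ c / m * (2 * K * (s' - s) + Metric.infDist (η s') Z + K) := by
  have hm0 : 0 < m := by linarith
  have step : ∀ s, m * f (η s) ≤ Metric.infDist (η s) Z →
      c * f (η s) ≤ c / m * Metric.infDist (η s) Z := fun s hs => by
    rw [div_mul_eq_mul_div, le_div_iff₀ hm0]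
    nlinarith
  induction N with
  | zero =>
    intro s s' _ hss _ hN hout u hu v hv
    obtain rfl : s = s' := le_antisymm hss (by simpa using hN)
    refine ((h _ _ (by simp [Metric.infDist_nonneg]) u hu v hv).trans
      (step s (hout s ⟨le_rfl, le_rfl⟩))).trans (mul_le_mul_of_nonneg_left ?_ (by positivity))
    linarith
  | succ N ih =>
    intro s s' hs hss hT hN hout u hu v hv
    have hs_out := hout s ⟨le_rfl, hss⟩
    rcases le_total (dist (η s) (η s')) (Metric.infDist (η s) Z) with hle | hle
    · refine ((h _ _ hle u hu v hv).trans (step s hs_out)).trans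
        (mul_le_mul_of_nonneg_left ?_ (by positivity))
      have h1 := hη.upper s s' hs hss hT
      have h2 : 0 ≤ K * (s' - s) := mul_nonneg (by linarith) (by linarith)
      linarith [Metric.infDist_le_infDist_add_dist (s := Z) (x := η s) (y := η s')]
    · obtain ⟨t, ht, hst⟩ := intermediate_value_Icc (f := fun t => dist (η s) (η t)) hss
        ((continuous_const.dist continuous_id).comp_continuousOn
          (hη.continuousOn.mono (Icc_subset_Icc hs hT)))
        (show Metric.infDist (η s) Z ∈ Icc (dist (η s) (η s)) (dist (η s) (η s')) from
          ⟨by simp [Metric.infDist_nonneg], hle⟩)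
      simp only at hst
      obtain ⟨w, hw⟩ := hZ (η t)
      have h1 := hη.upper s t hs ht.1 (ht.2.trans hT)
      have h3 : m ≤ Metric.infDist (η s) Z := by nlinarith [hf (η s)]
      -- A hop has length at least `m ≥ 2 * K`, hence takes time at least `1`. This drives the
      -- induction on `N` and absorbs the additive `K` in `h7`.
      have h4 : 1 ≤ t - s := by nlinarith
      have h5 := ih t s' (hs.trans ht.1) ht.2 hT (by push_cast at hN; linarith)
        (fun x hx => hout x ⟨ht.1.trans hx.1, hx.2⟩) w hw v hv
      have h6 := (h _ _ hst.le u hu w hw).trans (step s hs_out)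
      have h7 : c / m * Metric.infDist (η s) Z ≤ c / m * (2 * K * (t - s)) :=
        mul_le_mul_of_nonneg_left (by nlinarith) (by positivity)
      calc dist u v ≤ dist u w + dist w v := dist_triangle _ _ _
        _ ≤ c / m * (2 * K * (t - s)) +
            c / m * (2 * K * (s' - t) + Metric.infDist (η s') Z + K) := by linarith
        _ = _ := by ring

/-- A quasi-geodesic cannot stay away from a contracting set for long. -/
theorem IsWeightContracting.sub_le {f : X → ℝ} {c : ℝ} {Z : Set X} (hf : ∀ x, 1 ≤ f x)
    (hc : 0 ≤ c) (h : IsWeightContracting f c Z) (hZ : ∀ x, (nearestPoints Z x).Nonempty)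
    {K T : ℝ} {η : ℝ → X} (hη : IsQuasiGeodesicOn K T η) (hK : 1 ≤ K) {s s' : ℝ} (hs : 0 ≤ s)
    (hss : s ≤ s') (hT : s' ≤ T)
    (hout : ∀ t ∈ Icc s s', 4 * K ^ 2 * (c + 1) * f (η t) ≤ Metric.infDist (η t) Z) :
    s' - s ≤ 2 * K * (Metric.infDist (η s) Z + 2 * Metric.infDist (η s') Z + 2 * K) := by
  obtain ⟨u, hu⟩ := hZ (η s)
  obtain ⟨v, hv⟩ := hZ (η s')
  obtain ⟨N, hN⟩ := exists_nat_ge (s' - s)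
  have hm : 2 * K ≤ 4 * K ^ 2 * (c + 1) := by nlinarith [mul_nonneg (sq_nonneg K) hc]
  have hm0 : 0 < 4 * K ^ 2 * (c + 1) := by linarith
  have hK0 : 0 < K := by linarith
  have h1 := h.dist_le hf hc hZ hη hK hm N s s' hs hss hT hN hout u hu v hv
  -- The threshold is chosen so that, after multiplication by `K`, the projection contributes only
  -- `(s' - s) / 2`, as `h6` shows.
  have h2 : c / (4 * K ^ 2 * (c + 1)) ≤ 1 / (4 * K ^ 2) := by
    rw [div_le_div_iff₀ hm0 (by positivity)]
    nlinarith [sq_nonneg K]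
  have hd := Metric.infDist_nonneg (s := Z) (x := η s')
  have h0 : 0 ≤ s' - s := by linarith
  have h3 : c / (4 * K ^ 2 * (c + 1)) * (2 * K * (s' - s) + Metric.infDist (η s') Z + K) ≤
      1 / (4 * K ^ 2) * (2 * K * (s' - s) + Metric.infDist (η s') Z + K) :=
    mul_le_mul_of_nonneg_right h2 (by positivity)
  have h4 := hη.lower s s' hs hss hT
  have h5 : dist (η s) (η s') ≤ Metric.infDist (η s) Z + dist u v + Metric.infDist (η s') Z := by
    rw [← hu.2, ← hv.2, dist_comm (η s') v]
    exact dist_triangle4 _ _ _ _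
  have h6 : K * (1 / (4 * K ^ 2) * (2 * K * (s' - s) + Metric.infDist (η s') Z + K)) =
      (s' - s) / 2 + (Metric.infDist (η s') Z + K) / (4 * K) := by
    field_simp
    ring
  have h7 : (Metric.infDist (η s') Z + K) / (4 * K) ≤ K * (Metric.infDist (η s') Z + K) := by
    rw [div_le_iff₀ (by positivity)]
    have : 0 ≤ Metric.infDist (η s') Z + K := by positivity
    nlinarith [mul_nonneg this (mul_self_nonneg K), mul_nonneg this (by nlinarith : 0 ≤ K * K - 1)]
  have h8 := mul_le_mul_of_nonneg_left (h1.trans h3) hK0.le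
  have h9 := mul_le_mul_of_nonneg_left h5 hK0.le
  linarith

theorem IsContracting.exists_isWeightContracting {κ : SublinearFunction} {Z : Set X}
    (h : IsContracting κ o Z) :
    ∃ c, 0 ≤ c ∧ IsWeightContracting (fun x => κ (max (dist o x) 1)) c Z := by
  obtain ⟨c, hc⟩ := h
  refine ⟨max c 0, le_max_right _ _, fun x y hxy u hu v hv => ?_⟩
  refine (hc x y hxy u (Or.inl hu) v (Or.inr hv)).trans ?_
  exact mul_le_mul (le_max_left _ _) (κ.mono dist_nonneg (le_max_left _ _))
    (κ.pos dist_nonneg).le (le_max_right _ _)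

/-- A quasi-geodesic segment starting in a contracting set `Z` stays close to `Z` up to the last
time at which it is very close to `Z`. -/
theorem IsWeightContracting.exists_infDist_le {κ : SublinearFunction} {c : ℝ} {Z : Set X}
    (hc : 0 ≤ c) (h : IsWeightContracting (fun x => κ (max (dist o x) 1)) c Z)
    (hZ : ∀ x, (nearestPoints Z x).Nonempty) (ho : o ∈ Z) {K : ℝ} (hK : 1 ≤ K) :
    ∃ m, 0 ≤ m ∧ ∀ (T : ℝ) (η : ℝ → X), IsQuasiGeodesicOn K T η → η 0 = o →
      ∀ t s, 0 ≤ t → t ≤ s → s ≤ T →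
        Metric.infDist (η s) Z ≤ 4 * K ^ 2 * (c + 1) * κ (max (dist o (η s)) 1) →
        Metric.infDist (η t) Z ≤ m * κ (dist o (η t)) := by
  set m₀ := 4 * K ^ 2 * (c + 1) with hm₀
  have hm0 : 0 < m₀ := by positivity
  have hK0 : 0 < K := by linarith
  -- This `ε` makes the feedback term in the bound for the excursion length `b - a` equal to half of
  -- `b - a`.
  obtain ⟨C, hC, hκ⟩ := κ.exists_le_mul_add (ε := 1 / (12 * K ^ 2 * m₀)) (by positivity)
  set ε := 1 / (12 * K ^ 2 * m₀) with hε
  have hε0 : 0 < ε := by positivity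
  set A := 4 * K * (3 * m₀ * (1 + ε * (K + 1) + C) + 2 * K) with hA
  have hA0 : 0 < A := by positivity
  have hκ1 := κ.one_le 1 zero_le_one
  refine ⟨max (m₀ * κ 1) (m₀ * (1 + ε * (K * A + K + 1) + C) + K * A + K),
    le_max_of_le_right (by positivity), fun T η hη h0 t s ht hts hsT hs => ?_⟩
  have hkt := κ.one_le (dist o (η t)) dist_nonneg
  set g : ℝ → ℝ := fun u => Metric.infDist (η u) Z - m₀ * κ (max (dist o (η u)) 1) with hg
  have hgc : ContinuousOn g (Icc 0 T) := by
    have h1 : Continuous fun x : X => Metric.infDist x Z - m₀ * κ (max (dist o x) 1) :=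
      (Metric.continuous_infDist_pt Z).sub (continuous_const.mul
        (κ.continuous_map_max_one.comp (continuous_const.dist continuous_id)))
    exact h1.comp_continuousOn hη.continuousOn
  rcases le_total (g t) 0 with hgt | hgt
  · have h1 : Metric.infDist (η t) Z ≤ m₀ * κ (max (dist o (η t)) 1) := sub_nonpos.1 hgt
    refine h1.trans ((mul_le_mul_of_nonneg_left (κ.map_max_one_le dist_nonneg) hm0.le).trans ?_)
    rw [← mul_assoc]
    exact mul_le_mul_of_nonneg_right (le_max_left _ _) (by linarith)
  have hg0 : g 0 ≤ 0 := by
    have := κ.pos (zero_le_one.trans (le_max_right (dist o (η 0)) 1))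
    simp only [hg, h0, Metric.infDist_zero_of_mem ho]
    rw [h0] at this
    nlinarith
  -- `[a, b]` is the excursion around `t`. At both ends the distance to `Z` equals the threshold, so
  -- the length is bounded through `κ` at `η a` and `η b`, which `key` compares with `κ` at `η t`.
  obtain ⟨a, ha, ha0, hta⟩ := exists_last_zero ht
    (hgc.mono (Icc_subset_Icc_right (hts.trans hsT))) hg0 hgt
  obtain ⟨b, hb, hb0, htb⟩ := exists_first_zero hts
    (hgc.mono (Icc_subset_Icc ht hsT)) hgt (sub_nonpos.2 hs)
  have hbT := hb.2.trans hsT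
  have hlen := h.sub_le (fun x => κ.one_le _ (zero_le_one.trans (le_max_right _ _))) hc hZ hη hK
    ha.1 (ha.2.trans hb.1) hbT (fun u hu => by
      rcases le_total u t with hut | hut
      · exact sub_nonneg.1 (hta u ⟨hu.1, hut⟩)
      · exact sub_nonneg.1 (htb u ⟨hut, hu.2⟩))
  have hda : Metric.infDist (η a) Z = m₀ * κ (max (dist o (η a)) 1) := sub_eq_zero.1 ha0
  have hdb : Metric.infDist (η b) Z = m₀ * κ (max (dist o (η b)) 1) := sub_eq_zero.1 hb0
  have hab : 0 ≤ b - a := by linarith [ha.2, hb.1]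
  have hat : dist (η a) (η t) ≤ K * (b - a) + K :=
    (hη.upper a t ha.1 ha.2 (hts.trans hsT)).trans
      (by nlinarith [mul_le_mul_of_nonneg_left hb.1 hK0.le])
  have htb' : dist (η t) (η b) ≤ K * (b - a) + K :=
    (hη.upper t b ht hb.1 hbT).trans (by nlinarith [mul_le_mul_of_nonneg_left ha.2 hK0.le])
  have key : ∀ x, dist (η t) x ≤ K * (b - a) + K →
      κ (max (dist o x) 1) ≤ κ (dist o (η t)) + ε * (K * (b - a) + K + 1) + C := fun x hx => by
    have hD : 0 ≤ K * (b - a) + K + 1 := by positivity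
    have h1 : max (dist o x) 1 ≤ dist o (η t) + (K * (b - a) + K + 1) :=
      max_le (by linarith [dist_triangle o (η t) x])
        (by linarith [dist_nonneg (x := o) (y := η t), mul_nonneg hK0.le hab])
    linarith [κ.mono (zero_le_one.trans (le_max_right _ _)) h1, κ.map_add_le (dist_nonneg (x := o) (y := η t)) hD,
      hκ _ hD]
  have hka := key (η a) (by rwa [dist_comm])
  have hkb := key (η b) htb'
  have hL : b - a ≤ A * κ (dist o (η t)) := by
    have h1 : 2 * K * (3 * m₀ * (ε * (K * (b - a)))) = (b - a) / 2 := by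
      rw [hε]
      field_simp
      norm_num
    have h2 := mul_le_mul_of_nonneg_left hka hm0.le
    have h3 := mul_le_mul_of_nonneg_left hkb hm0.le
    have h4 : b - a ≤ 2 * K * (3 * (m₀ * (κ (dist o (η t)) + ε * (K * (b - a) + K + 1) + C))
        + 2 * K) := by
      refine hlen.trans (mul_le_mul_of_nonneg_left ?_ (by positivity))
      linarith
    have h5 : A * κ (dist o (η t)) =
        4 * K * (3 * m₀ * κ (dist o (η t))) +
          4 * K * (3 * m₀ * (ε * (K + 1) + C) + 2 * K) * κ (dist o (η t)) := by
      rw [hA]; ring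
    have h6 : 4 * K * (3 * m₀ * (ε * (K + 1) + C) + 2 * K) ≤
        4 * K * (3 * m₀ * (ε * (K + 1) + C) + 2 * K) * κ (dist o (η t)) :=
      le_mul_of_one_le_right (by positivity) hkt
    linarith
  have h1 := Metric.infDist_le_infDist_add_dist (s := Z) (x := η t) (y := η a)
  rw [dist_comm] at h1
  have h2 := mul_le_mul_of_nonneg_left hka hm0.le
  have h3 := mul_le_mul_of_nonneg_left hL hK0.le
  refine le_trans ?_ (mul_le_mul_of_nonneg_right (le_max_right _ _) (by linarith))
  have h4 : m₀ * ε * (K * (b - a)) ≤ m₀ * ε * (K * (A * κ (dist o (η t)))) :=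
    mul_le_mul_of_nonneg_left h3 (by positivity)
  have h5 : m₀ * (ε * (K + 1) + C) + K ≤ (m₀ * (ε * (K + 1) + C) + K) * κ (dist o (η t)) :=
    le_mul_of_one_le_right (by positivity) hkt
  have h6 : (m₀ * (1 + ε * (K * A + K + 1) + C) + K * A + K) * κ (dist o (η t)) =
      m₀ * κ (dist o (η t)) + m₀ * ε * (K * (A * κ (dist o (η t)))) +
        (m₀ * (ε * (K + 1) + C) + K) * κ (dist o (η t)) + K * (A * κ (dist o (η t))) := by
    ring
  rw [h6]
  linarith

/-- The last time a quasi-geodesic segment is very close to a contracting set is not much earlier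
than any time at which it is close. -/
theorem IsWeightContracting.exists_time_infDist_le {κ : SublinearFunction} {c : ℝ} {Z : Set X}
    (hc : 0 ≤ c) (h : IsWeightContracting (fun x => κ (max (dist o x) 1)) c Z)
    (hZ : ∀ x, (nearestPoints Z x).Nonempty) (ho : o ∈ Z) {K T : ℝ} (hK : 1 ≤ K) {η : ℝ → X}
    (hη : IsQuasiGeodesicOn K T η) (h0 : η 0 = o) (hT : 0 ≤ T) :
    ∃ s ∈ Icc 0 T, Metric.infDist (η s) Z ≤ 4 * K ^ 2 * (c + 1) * κ (max (dist o (η s)) 1) ∧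
      T - s ≤ 2 * K * (4 * K ^ 2 * (c + 1) * κ (max (dist o (η s)) 1) +
        2 * Metric.infDist (η T) Z + 2 * K) := by
  have hκ : ∀ x : X, 0 < κ (max (dist o x) 1) :=
    fun x => κ.pos (zero_le_one.trans (le_max_right _ _))
  rcases le_total (Metric.infDist (η T) Z) (4 * K ^ 2 * (c + 1) * κ (max (dist o (η T)) 1))
    with hle | hle
  · refine ⟨T, ⟨hT, le_rfl⟩, hle, ?_⟩
    have := hκ (η T)
    have := Metric.infDist_nonneg (s := Z) (x := η T)
    rw [sub_self]
    positivity
  · have hgc : ContinuousOn (fun u => Metric.infDist (η u) Z -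
        4 * K ^ 2 * (c + 1) * κ (max (dist o (η u)) 1)) (Icc 0 T) := by
      have h1 : Continuous fun x : X => Metric.infDist x Z -
          4 * K ^ 2 * (c + 1) * κ (max (dist o x) 1) :=
        (Metric.continuous_infDist_pt Z).sub (continuous_const.mul
          (κ.continuous_map_max_one.comp (continuous_const.dist continuous_id)))
      exact h1.comp_continuousOn hη.continuousOn
    obtain ⟨s, hs, hs0, hst⟩ := exists_last_zero hT hgc
      (by
        have := hκ o
        simp only [h0, Metric.infDist_zero_of_mem ho, zero_sub, neg_nonpos]
        positivity) (sub_nonneg.2 hle)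
    have hlen := h.sub_le (fun x => κ.one_le _ (zero_le_one.trans (le_max_right _ _))) hc hZ hη hK
      hs.1 hs.2 le_rfl (fun u hu => sub_nonneg.1 (hst u hu))
    rw [sub_eq_zero.1 hs0] at hlen
    exact ⟨s, hs, (sub_eq_zero.1 hs0).le, hlen⟩

/-- The last time at which `η` is very close to `Z` precedes `t_R` by an amount sublinear in `R`, so
for large `R` it comes after `t_r`. All of `η|_r` is then controlled by `exists_infDist_le`. -/
theorem IsContracting.exists_isMorseGauge {κ : SublinearFunction} {Z : Set X}
    (h : IsContracting κ o Z) (hZ : ∀ x, (nearestPoints Z x).Nonempty) (ho : o ∈ Z) :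
    ∃ m, IsMorseGauge κ o Z m := by
  obtain ⟨c, hc, hw⟩ := h.exists_isWeightContracting
  choose m hm0 hm using fun K : {K : ℝ // 1 ≤ K} => hw.exists_infDist_le hc hZ ho K.2
  have hK1 : ∀ q Q : ℝ, 1 ≤ max 1 (max q Q) := fun q Q => le_max_left _ _
  refine ⟨fun q Q => max (m ⟨_, hK1 q Q⟩) (4 * (max 1 (max q Q)) ^ 2 * (c + 1)), ?_, ?_⟩
  · intro q Q _ _
    refine le_max_of_le_right ((le_max_right 1 _).trans ?_)
    nlinarith [hK1 q Q, mul_nonneg (sq_nonneg (max 1 (max q Q))) hc]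
  · intro r hr n hn κ''
    set C := max 1 (r / (2 * κ r)) with hC
    have hC1 : 1 ≤ C := le_max_left _ _
    -- The terms in `κ R` and `κ'' R` will cost at most `R / 8` each, and `r` with the constants
    -- less than `R / 2`.
    obtain ⟨R, hR1, hRκ, hRκ'', hRr⟩ := ((eventually_ge_atTop (max 1 r)).and
      ((κ.eventually_le (ε := 1 / (16 * C ^ 3)) (by positivity)).and
      ((κ''.eventually_le (ε := 1 / (32 * C ^ 2 * n)) (by positivity)).and
      (eventually_gt_atTop (2 * (r + C + 4 * C ^ 3)))))).exists
    have hR0 : 0 < R := one_pos.trans_le ((le_max_left _ _).trans hR1)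
    refine ⟨R, hR0, fun q Q η hη hsmall hnear => ?_⟩
    set K := max 1 (max q Q) with hK
    -- The threshold was put into the gauge so that smallness bounds it, and hence `K`, by a number
    -- depending only on `r`.
    have hKm : 4 * K ^ 2 * (c + 1) ≤ C :=
      (le_max_right _ _).trans (hsmall.trans (le_max_right _ _))
    have hKC : K ≤ C := by nlinarith [hK1 q Q, mul_nonneg (sq_nonneg K) hc]
    have hηK := hη.isQuasiGeodesicOn (K := K) ((le_max_left q Q).trans (le_max_right 1 _))
      ((le_max_right q Q).trans (le_max_right 1 _)) (firstTime o η R)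
    obtain ⟨s, hs, hsZ, hlen⟩ := hw.exists_time_infDist_le hc hZ ho (hK1 q Q) hηK
      (by simpa using hη.start) (NNReal.coe_nonneg _)
    simp only [Real.toNNReal_coe] at hlen
    have hsR : dist o (η s.toNNReal) ≤ R :=
      hη.dist_le_of_le_firstTime hR0.le (Real.toNNReal_le_iff_le_coe.2 hs.2)
    have hκs : κ (max (dist o (η s.toNNReal)) 1) ≤ κ R :=
      κ.mono (zero_le_one.trans (le_max_right _ _)) (max_le hsR ((le_max_left _ _).trans hR1))
    have hκR := κ.pos hR0.le
    have hlen' : firstTime o η R - s ≤ 2 * C * (C * κ R + 2 * (n * κ'' R) + 2 * C) := by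
      have h1 := κ''.pos hR0.le
      refine hlen.trans (mul_le_mul (by linarith) ?_ ?_ (by positivity))
      · have := mul_le_mul hKm hκs (κ.pos (zero_le_one.trans (le_max_right _ _))).le (by positivity)
        linarith
      · have := κ.pos (zero_le_one.trans (le_max_right (dist o (η s.toNNReal)) 1))
        have := Metric.infDist_nonneg (s := Z) (x := η (firstTime o η R))
        positivity
    have hrs : (firstTime o η r : ℝ) ≤ s := by
      by_contra! hlt
      have h1 := (hη.mono (q' := C) (Q' := C) (by
        exact ((le_max_left q Q).trans (le_max_right 1 _)).trans hKC) (by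
        exact ((le_max_right q Q).trans (le_max_right 1 _)).trans hKC)).upper
          (firstTime o η r) (firstTime o η R)
      have hmono : (firstTime o η r : ℝ) ≤ firstTime o η R :=
        NNReal.coe_le_coe.2 (firstTime_mono hη hr.le ((le_max_right _ _).trans hR1))
      rw [NNReal.dist_eq, abs_sub_comm, abs_of_nonneg (sub_nonneg.2 hmono)] at h1
      have h2 := dist_triangle o (η (firstTime o η r)) (η (firstTime o η R))
      rw [hη.dist_firstTime hr.le, hη.dist_firstTime hR0.le] at h2
      have h3 : C * (firstTime o η R - firstTime o η r) ≤
          C * (2 * C * (C * κ R + 2 * (n * κ'' R) + 2 * C)) :=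
        mul_le_mul_of_nonneg_left (by linarith) (by positivity)
      have h4 : 2 * C ^ 3 * κ R ≤ R / 8 := by
        refine (mul_le_mul_of_nonneg_left hRκ (by positivity)).trans_eq ?_
        field_simp
        norm_num
      have h5 : 4 * C ^ 2 * n * κ'' R ≤ R / 8 := by
        refine (mul_le_mul_of_nonneg_left hRκ'' (by positivity)).trans_eq ?_
        field_simp
        norm_num
      nlinarith
    rintro _ ⟨t, ht, rfl⟩
    have hts : (t : ℝ) ≤ s := (NNReal.coe_le_coe.2 ht).trans hrs
    have := hm ⟨K, hK1 q Q⟩ _ _ hηK (by simpa using hη.start) t s t.coe_nonneg hts hs.2 hsZ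
    simp only [Real.toNNReal_coe] at this
    exact this.trans (mul_le_mul_of_nonneg_right (le_max_left _ _) (κ.pos dist_nonneg).le)

/-! ### Fellow traveling of contracting rays -/

theorem IsQuasiGeodesicRay.nearestPoints_nonempty [ProperSpace X] {q Q : ℝ} {β : ℝ≥0 → X}
    (h : IsQuasiGeodesicRay o q Q β) (x : X) : (nearestPoints (range β) x).Nonempty := by
  obtain ⟨t, -, ht⟩ := h.exists_infDist_image_eq isClosed_univ univ_nonempty x
  rw [image_univ] at ht
  exact ⟨β t, mem_range_self t, ht.symm⟩

theorem QuasiGeodesicRay.nearestPoints_nonempty [ProperSpace X] (β : QuasiGeodesicRay o) (x : X) :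
    (nearestPoints (range β.1) x).Nonempty := by
  obtain ⟨q, Q, h⟩ := β.2
  exact h.nearestPoints_nonempty x

theorem QuasiGeodesicRay.mem_range (β : QuasiGeodesicRay o) : o ∈ range β.1 := ⟨0, β.start⟩

/-- If a quasi-geodesic ray stays sublinearly close to another one, then the converse holds. -/
theorem exists_range_subset_kappaNeighborhood [ProperSpace X] {κ : SublinearFunction}
    {β γ : QuasiGeodesicRay o} (h : ∃ n, range γ.1 ⊆ kappaNeighborhood κ o (range β.1) n) :
    ∃ n, range β.1 ⊆ kappaNeighborhood κ o (range γ.1) n := by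
  obtain ⟨n₀, hn₀⟩ := h
  set n := max n₀ 0
  have hn : range γ.1 ⊆ kappaNeighborhood κ o (range β.1) n :=
    hn₀.trans (kappaNeighborhood_mono κ (le_max_left _ _))
  have hn0 : 0 ≤ n := le_max_right _ _
  obtain ⟨q, Q, hβ⟩ := β.2
  obtain ⟨q', Q', hγ⟩ := γ.2
  have hq := one_pos.trans_le hβ.one_le
  have hQ := hβ.nonneg
  set E := q * (q * (2 * n + Q)) + Q + n with hE
  have hE0 : 0 ≤ E := by positivity
  obtain ⟨C, hC, hκ⟩ := κ.exists_le_mul_add (ε := 1 / (2 * (E + 1))) (by positivity)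
  refine ⟨E * (2 + 2 * C), ?_⟩
  rintro _ ⟨s, rfl⟩
  have hmin : ∀ x, ∃ t₁ ∈ Iic s, ∃ t₂ ∈ Ici s, Metric.infDist x (β.1 '' Iic s) = dist x (β.1 t₁) ∧
      Metric.infDist x (β.1 '' Ici s) = dist x (β.1 t₂) ∧
      min (dist x (β.1 t₁)) (dist x (β.1 t₂)) ≤ Metric.infDist x (range β.1) := fun x => by
    obtain ⟨t₁, h₁, ht₁⟩ := hβ.exists_infDist_image_eq (isClosed_Iic (a := s)) ⟨s, self_mem_Iic⟩ x
    obtain ⟨t₂, h₂, ht₂⟩ := hβ.exists_infDist_image_eq (isClosed_Ici (a := s)) ⟨s, self_mem_Ici⟩ x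
    obtain ⟨t, -, ht⟩ := hβ.exists_infDist_image_eq isClosed_univ univ_nonempty x
    refine ⟨t₁, h₁, t₂, h₂, ht₁, ht₂, ?_⟩
    rw [← ht₁, ← ht₂, ← image_univ, ht]
    rcases le_total t s with hts | hts
    · exact min_le_of_left_le (Metric.infDist_le_dist_of_mem (mem_image_of_mem _ hts))
    · exact min_le_of_right_le (Metric.infDist_le_dist_of_mem (mem_image_of_mem _ hts))
  -- `γ` starts on the past of `β` relative to `s` and ends up at least as close to its future, so
  -- some `γ t` is equidistant from both. Its nearest points `β t₁`, `β t₂` have `t₁ ≤ s ≤ t₂` and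
  -- are close together, which puts `β s` near `γ t`.
  set f : ℝ≥0 → ℝ := fun t =>
    Metric.infDist (γ.1 t) (β.1 '' Iic s) - Metric.infDist (γ.1 t) (β.1 '' Ici s) with hf
  have hfc : Continuous f :=
    ((Metric.continuous_infDist_pt _).comp hγ.continuous).sub
      ((Metric.continuous_infDist_pt _).comp hγ.continuous)
  have hf0 : f 0 ≤ 0 := by
    have : γ.1 0 ∈ β.1 '' Iic s := ⟨0, mem_Iic.2 zero_le, by rw [β.start, γ.start]⟩
    simp [hf, Metric.infDist_zero_of_mem this, Metric.infDist_nonneg]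
  -- Otherwise `γ t` would lie within half its norm of the bounded set `β '' Iic s`, impossible for
  -- large norm.
  have hlarge : ∃ t, 0 ≤ f t := by
    have h1 := hγ.tendsto_dist.eventually (κ.eventually_le (ε := 1 / (2 * (n + 1))) (by positivity))
    obtain ⟨t, ht, ht'⟩ :=
      (h1.and (hγ.tendsto_dist.eventually_gt_atTop (2 * (q * s + Q)))).exists
    refine ⟨t, ?_⟩
    by_contra! hlt
    obtain ⟨t₁, h₁, t₂, h₂, ht₁, ht₂, hle⟩ := hmin (γ.1 t)
    simp only [hf, ht₁, ht₂, sub_neg] at hlt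
    rw [min_eq_left hlt.le] at hle
    have h2 : Metric.infDist (γ.1 t) (range β.1) ≤ n * κ (dist o (γ.1 t)) := hn (mem_range_self t)
    have h3 : n * κ (dist o (γ.1 t)) ≤ dist o (γ.1 t) / 2 := by
      refine (mul_le_mul_of_nonneg_left ht hn0).trans ?_
      rw [show n * (1 / (2 * (n + 1)) * dist o (γ.1 t)) =
        n * dist o (γ.1 t) / (2 * (n + 1)) by ring, div_le_div_iff₀ (by positivity) two_pos]
      nlinarith [dist_nonneg (x := o) (y := γ.1 t)]
    have h4 := hβ.upper 0 t₁
    rw [hβ.start, NNReal.dist_eq, NNReal.coe_zero, zero_sub, abs_neg,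
      abs_of_nonneg t₁.coe_nonneg] at h4
    have h5 : q * (t₁ : ℝ) ≤ q * s := mul_le_mul_of_nonneg_left (NNReal.coe_le_coe.2 h₁) hq.le
    have h6 := dist_triangle o (β.1 t₁) (γ.1 t)
    rw [dist_comm (β.1 t₁)] at h6
    linarith
  obtain ⟨T, hT⟩ := hlarge
  obtain ⟨t, -, ht⟩ := intermediate_value_Icc (zero_le : 0 ≤ T) hfc.continuousOn ⟨hf0, hT⟩
  obtain ⟨t₁, h₁, t₂, h₂, ht₁, ht₂, hle⟩ := hmin (γ.1 t)
  have heq : dist (γ.1 t) (β.1 t₁) = dist (γ.1 t) (β.1 t₂) := by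
    rw [← ht₁, ← ht₂]; exact sub_eq_zero.1 ht
  rw [← heq, min_self] at hle
  set k := κ (dist o (γ.1 t)) with hk
  have hk1 : 1 ≤ k := κ.one_le _ dist_nonneg
  have hD : dist (γ.1 t) (β.1 t₁) ≤ n * k := hle.trans (hn (mem_range_self t))
  have h12 : dist t₁ t₂ ≤ q * (2 * (n * k) + Q) := by
    refine (hβ.dist_le_mul t₁ t₂).trans (mul_le_mul_of_nonneg_left ?_ hq.le)
    have := dist_triangle_left (β.1 t₁) (β.1 t₂) (γ.1 t)
    linarith
  have h1s : dist s t₁ ≤ dist t₁ t₂ := by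
    have h3 : (t₁ : ℝ) ≤ s := NNReal.coe_le_coe.2 h₁
    have h4 : (s : ℝ) ≤ t₂ := NNReal.coe_le_coe.2 h₂
    rw [NNReal.dist_eq, NNReal.dist_eq, abs_of_nonneg (by linarith), abs_sub_comm,
      abs_of_nonneg (by linarith)]
    linarith
  have hdist : dist (β.1 s) (γ.1 t) ≤ E * k := by
    have h3 := dist_triangle_right (β.1 s) (γ.1 t) (β.1 t₁)
    have h4 := hβ.upper s t₁
    have h5 := mul_le_mul_of_nonneg_left (h1s.trans h12) hq.le
    have h6 : Q ≤ Q * k := le_mul_of_one_le_right hQ hk1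
    have h7 : q * (q * Q) ≤ q * (q * (Q * k)) := by gcongr
    rw [hE]
    linarith
  have hkle : k ≤ (2 + 2 * C) * κ (dist o (β.1 s)) := by
    have h0 : 0 ≤ E * k := by positivity
    have h3 : dist o (γ.1 t) ≤ dist o (β.1 s) + E * k := by
      linarith [dist_triangle o (β.1 s) (γ.1 t)]
    have h4 := κ.mono dist_nonneg h3
    have h5 := κ.map_add_le (dist_nonneg (x := o) (y := β.1 s)) h0
    have h6 := hκ _ h0
    have h7 : 1 / (2 * (E + 1)) * (E * k) ≤ k / 2 := by
      rw [div_mul_eq_mul_div, one_mul, div_le_div_iff₀ (by positivity) two_pos]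
      nlinarith
    have h8 := κ.one_le (dist o (β.1 s)) dist_nonneg
    nlinarith
  calc Metric.infDist (β.1 s) (range γ.1) ≤ dist (β.1 s) (γ.1 t) :=
        Metric.infDist_le_dist_of_mem (mem_range_self t)
    _ ≤ E * k := hdist
    _ ≤ E * ((2 + 2 * C) * κ (dist o (β.1 s))) := mul_le_mul_of_nonneg_left hkle hE0
    _ = _ := by ring

/-- Closeness to `Z` at scale `κ''` becomes closeness to `Y` at scale `κ + κ''`, which the gauge of
`Y` accepts. -/
theorem IsMorseGauge.of_subset {κ : SublinearFunction} {Y Z : Set X} {m : ℝ → ℝ → ℝ}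
    (hm : IsMorseGauge κ o Y m) (hY : Y.Nonempty) (hZ : Z.Nonempty)
    (hYZ : ∃ n, Y ⊆ kappaNeighborhood κ o Z n) (hZY : ∃ n, Z ⊆ kappaNeighborhood κ o Y n) :
    ∃ m', IsMorseGauge κ o Z m' := by
  obtain ⟨n₁, hn₁⟩ := hYZ
  obtain ⟨n₂, hn₂⟩ := hZY
  replace hn₁ := hn₁.trans (kappaNeighborhood_mono κ (le_max_left n₁ 0))
  replace hn₂ := hn₂.trans (kappaNeighborhood_mono κ (le_max_left n₂ 0))
  have hn20 := le_max_right n₂ 0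
  choose N hN0 hN using fun q Q =>
    kappaNeighborhood_comp (o := o) κ (le_max_right (m q Q) 0) (le_max_right n₁ 0)
  obtain ⟨C, hC, htrans⟩ := infDist_le_trans (o := o) κ hn20
  refine ⟨fun q Q => max (m q Q) (N q Q), fun q Q hq hQ => le_max_of_le_left (hm.1 q Q hq hQ),
    fun r hr n hn κ'' => ?_⟩
  obtain ⟨R, hR, h⟩ := hm.2 r hr (n + 1 + max n₂ 0 * (1 + n + C)) (by positivity) (κ + κ'')
  refine ⟨R, hR, fun q Q η hη hsmall hnear => ?_⟩
  have h1 := h q Q η hη ((le_max_left _ _).trans hsmall) ?_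
  · exact ((h1.trans (kappaNeighborhood_mono κ (le_max_left _ _))).trans
      (hN q Q Y Z hY hn₁)).trans (kappaNeighborhood_mono κ (le_max_right _ _))
  · have hk := κ.one_le R hR.le
    have hk' := κ''.one_le R hR.le
    have h2 := htrans (η (firstTime o η R)) (n * κ'' R) Z Y (by positivity) hZ hn₂ hnear
    rw [hη.dist_firstTime hR.le] at h2
    refine h2.trans ?_
    rw [SublinearFunction.add_apply]
    have h3 : κ R + n * κ'' R + C ≤ (1 + n + C) * (κ R + κ'' R) := by nlinarith
    have h4 := mul_le_mul_of_nonneg_left h3 hn20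
    nlinarith

/-- A Morse gauge controls all rays which are sublinearly close. -/
theorem IsMorseGauge.fellowTravel [ProperSpace X] {κ κ' : SublinearFunction}
    {β γ : QuasiGeodesicRay o} {m : ℝ → ℝ → ℝ} (hm : IsMorseGauge κ' o (range β.1) m)
    (h : FellowTravel κ β γ) : FellowTravel κ' β γ := by
  obtain ⟨n, hn⟩ := h.2
  obtain ⟨q, Q, hγ⟩ := γ.2
  have h1 : ∃ n, range γ.1 ⊆ kappaNeighborhood κ' o (range β.1) n := by
    refine ⟨m q Q, hγ.range_subset ?_⟩
    filter_upwards [eventually_smallComparedTo κ' (m q Q), eventually_gt_atTop 0] with r hr hr0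
    obtain ⟨R, hR, h⟩ := hm.2 r hr0 (max n 1) (lt_max_of_lt_right one_pos) κ
    refine h q Q γ.1 hγ hr ?_
    have := hn.trans (kappaNeighborhood_mono κ (le_max_left n 1))
      (mem_range_self (firstTime o γ.1 R))
    simpa only [kappaNeighborhood, mem_ofPred_eq, hγ.dist_firstTime hR.le] using this
  exact ⟨exists_range_subset_kappaNeighborhood h1, h1⟩

/-- The factor `M` works twice: it enlarges the neighbourhood, and it turns smallness for `κ` into
smallness for `κ'`. -/
theorem IsMorseGauge.of_le {κ κ' : SublinearFunction} {M : ℝ} (hM : 1 ≤ M)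
    (h : ∀ t, 0 ≤ t → κ' t ≤ M * κ t) {Z : Set X} {m : ℝ → ℝ → ℝ} (hm : IsMorseGauge κ' o Z m) :
    IsMorseGauge κ o Z fun q Q => M * m q Q := by
  have hpos : ∀ q Q : ℝ, 1 ≤ q → 0 ≤ Q → 0 ≤ m q Q := fun q Q hq hQ =>
    (hQ.trans (le_max_right q Q)).trans (hm.1 q Q hq hQ)
  refine ⟨fun q Q hq hQ => (hm.1 q Q hq hQ).trans
    (le_mul_of_one_le_left (hpos q Q hq hQ) hM), fun r hr n hn κ'' => ?_⟩
  obtain ⟨R, hR, hh⟩ := hm.2 r hr n hn κ''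
  refine ⟨R, hR, fun q Q η hη hsmall hnear => (hh q Q η hη ?_ hnear).trans
    (kappaNeighborhood_subset (hpos q Q hη.one_le hη.nonneg) h Z)⟩
  have hk := κ.pos hr.le
  have hk' := κ'.pos hr.le
  have hp := hpos q Q hη.one_le hη.nonneg
  simp only [SmallComparedTo] at hsmall ⊢
  rw [le_div_iff₀ (by positivity)] at hsmall ⊢
  nlinarith [mul_le_mul_of_nonneg_left (h r hr.le) hp]

/-! ### Geodesic rays -/

theorem IsGeodesicSegment.lipschitzWith {γ : ℝ → X} {p q : X} (h : IsGeodesicSegment γ p q) :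
    LipschitzWith 1 fun t : ℝ≥0 => γ (min t (dist p q)) := by
  refine LipschitzWith.of_dist_le_mul fun s t => ?_
  rw [h.2.2 _ ⟨le_min s.coe_nonneg dist_nonneg, min_le_right _ _⟩ _
    ⟨le_min t.coe_nonneg dist_nonneg, min_le_right _ _⟩, NNReal.dist_eq, NNReal.coe_one, one_mul]
  exact (abs_min_sub_min_le_max _ _ _ _).trans (by simp)

theorem IsGeodesicSegment.isQuasiGeodesicOn {γ : ℝ → X} {p q : X} (h : IsGeodesicSegment γ p q) :
    IsQuasiGeodesicOn 1 (dist p q) γ := by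
  have hd : ∀ s t, 0 ≤ s → s ≤ t → t ≤ dist p q → dist (γ s) (γ t) = t - s :=
    fun s t hs hst ht => by
      rw [h.2.2 s ⟨hs, hst.trans ht⟩ t ⟨hs.trans hst, ht⟩, abs_sub_comm,
        abs_of_nonneg (sub_nonneg.2 hst)]
  refine ⟨?_, fun s t hs hst ht => ?_, fun s t hs hst ht => ?_⟩
  · have hl : LipschitzOnWith 1 γ (Icc 0 (dist p q)) :=
      LipschitzOnWith.of_dist_le_mul fun s hs t ht => by
        rw [h.2.2 s hs t ht, Real.dist_eq, NNReal.coe_one, one_mul]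
    exact hl.continuousOn
  · rw [hd s t hs hst ht]; linarith
  · rw [hd s t hs hst ht]; linarith

/-- Every class of a contracting ray contains a geodesic ray. -/
theorem IsContracting.exists_isometry_fellowTravel [ProperSpace X] (hX : IsCAT0 X)
    {κ : SublinearFunction} {β : QuasiGeodesicRay o} (h : IsContracting κ o (range β.1)) :
    ∃ b : QuasiGeodesicRay o, Isometry b.1 ∧ FellowTravel κ β b := by
  obtain ⟨q, Q, hβ⟩ := β.2
  obtain ⟨c, hc, hw⟩ := h.exists_isWeightContracting
  obtain ⟨m, hm0, hm⟩ := hw.exists_infDist_le hc β.nearestPoints_nonempty β.mem_range le_rfl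
  choose γ hγ using fun t => hX.geodesic o (β.1 t)
  set f : ℝ≥0 → ℝ≥0 → X := fun t x => γ t (min x (dist o (β.1 t))) with hf
  have hfx : ∀ t (x : ℝ≥0), (x : ℝ) ≤ dist o (β.1 t) → f t x = γ t x := fun t x hx => by
    simp only [hf, min_eq_left hx]
  have hd : ∀ t (x : ℝ≥0), (x : ℝ) ≤ dist o (β.1 t) → dist o (γ t x) = x := fun t x hx => by
    have := (hγ t).2.2 0 ⟨le_rfl, dist_nonneg⟩ x ⟨x.coe_nonneg, hx⟩
    rwa [(hγ t).1, zero_sub, abs_neg, abs_of_nonneg x.coe_nonneg] at this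
  have hf0 : ∀ t, f t 0 = o := fun t => by
    rw [hfx t 0 (by simp), NNReal.coe_zero, (hγ t).1]
  have hmem : ∀ t (x : ℝ≥0), f t x ∈ Metric.closedBall o x := fun t x => by
    have := (hγ t).lipschitzWith.dist_le_mul x 0
    rw [NNReal.coe_one, one_mul, NNReal.dist_eq, NNReal.coe_zero, sub_zero,
      abs_of_nonneg x.coe_nonneg] at this
    rw [Metric.mem_closedBall, ← hf0 t]
    exact this
  -- The geodesic ray is the pointwise limit, along an ultrafilter, of the segments from `o` to `β
  -- t`; each point stays in a compact ball.
  set U : Ultrafilter ℝ≥0 := Ultrafilter.of atTop with hU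
  have hU' : (U : Filter ℝ≥0) ≤ atTop := Ultrafilter.of_le _
  have hlim : ∀ x, ∃ z, Tendsto (fun t => f t x) U (𝓝 z) := fun x => by
    obtain ⟨z, -, hz⟩ := (isCompact_closedBall o (x : ℝ)).ultrafilter_le_nhds
      (U.map fun t => f t x) (by
        rw [le_principal_iff]
        exact Filter.mem_map.2 (univ_mem' fun t => hmem t x))
    exact ⟨z, hz⟩
  choose b hb using hlim
  have hev : ∀ x : ℝ≥0, ∀ᶠ t in (U : Filter ℝ≥0), (x : ℝ) ≤ dist o (β.1 t) := fun x =>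
    hU' (hβ.tendsto_dist.eventually_ge_atTop x)
  have hiso : Isometry b := Isometry.of_dist_eq fun x y => by
    refine tendsto_nhds_unique ((hb x).dist (hb y)) (Tendsto.congr' ?_ tendsto_const_nhds)
    filter_upwards [hev x, hev y] with t hx hy
    rw [hfx t x hx, hfx t y hy, (hγ t).2.2 x ⟨x.coe_nonneg, hx⟩ y ⟨y.coe_nonneg, hy⟩,
      NNReal.dist_eq]
  have hb0 : b 0 = o := tendsto_nhds_unique (hb 0) (by simp only [hf0, tendsto_const_nhds])
  refine ⟨⟨b, 1, 0, .of_isometry hiso hb0⟩, hiso, ?_⟩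
  have h1 : ∃ n, range b ⊆ kappaNeighborhood κ o (range β.1) n := by
    refine ⟨m, ?_⟩
    rintro _ ⟨x, rfl⟩
    have h2 : Tendsto (fun t => Metric.infDist (f t x) (range β.1)) U
        (𝓝 (Metric.infDist (b x) (range β.1))) :=
      ((Metric.continuous_infDist_pt _).tendsto _).comp (hb x)
    refine le_of_tendsto h2 ?_
    filter_upwards [hev x] with t hx
    -- Each segment ends on `β`, so all of it is controlled, with `m` independent of `t`.
    have h3 := hm _ _ (hγ t).isQuasiGeodesicOn (hγ t).1 x _ x.coe_nonneg hx le_rfl (by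
      rw [(hγ t).2.1, Metric.infDist_zero_of_mem (mem_range_self t)]
      have := κ.pos (zero_le_one.trans (le_max_right (dist o (β.1 t)) 1))
      positivity)
    rwa [hd t x hx, ← hfx t x hx, ← dist_isometry hiso hb0 x] at h3
  exact ⟨exists_range_subset_kappaNeighborhood (γ := ⟨b, 1, 0, .of_isometry hiso hb0⟩) h1, h1⟩

/-! ### Surgery of quasi-geodesic rays -/

/-- The path which follows `f` up to time `τ`, and then `g`. -/
noncomputable def concatPath {X : Type*} (f : ℝ≥0 → X) (τ : ℝ≥0) (g : ℝ≥0 → X) (t : ℝ≥0) : X :=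
  if t ≤ τ then f t else g (t - τ)

theorem concatPath_of_le {X : Type*} {f g : ℝ≥0 → X} {τ t : ℝ≥0} (h : t ≤ τ) : concatPath f τ g t = f t :=
  if_pos h

theorem concatPath_add {X : Type*} {f g : ℝ≥0 → X} {τ : ℝ≥0} (h : f τ = g 0) (e : ℝ≥0) :
    concatPath f τ g (τ + e) = g e := by
  rcases eq_or_ne e 0 with rfl | he
  · rw [add_zero, concatPath_of_le le_rfl, h]
  · rw [concatPath, if_neg (not_le.2 (lt_add_of_pos_right τ (pos_iff_ne_zero.2 he))),
      add_tsub_cancel_left]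

theorem continuous_concatPath {f g : ℝ≥0 → X} {τ : ℝ≥0} (hf : Continuous f) (hg : Continuous g)
    (h : f τ = g 0) : Continuous (concatPath f τ g) := by
  refine Continuous.if_le hf (hg.comp (continuous_id.sub continuous_const)) continuous_id
    continuous_const fun t ht => ?_
  obtain rfl : t = τ := ht
  simp [h]

/-- A quasi-geodesic ray which is close at radius `ρ` to a geodesic ray can be modified beyond
radius `ρ / 2` so that it eventually follows the geodesic ray. -/
theorem IsQuasiGeodesicRay.exists_surgery [ProperSpace X] (hX : IsCAT0 X) {K : ℝ} {α a : ℝ≥0 → X}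
    (hα : IsQuasiGeodesicRay o K K α) (ha : Isometry a) (ha0 : a 0 = o) {ρ : ℝ} (hρ : 0 < ρ)
    (hclose : Metric.infDist (α (firstTime o α ρ)) (range a) ≤ ρ / 4) :
    ∃ η, IsQuasiGeodesicRay o (4 * K) (4 * K) η ∧ (∃ T S : ℝ≥0, ∀ t, η (T + t) = a (S + t)) ∧
      ∃ τ, ρ / 2 ≤ dist o (α τ) ∧ ∀ t ≤ τ, η t = α t := by
  have hK := hα.one_le
  have haq := IsQuasiGeodesicRay.of_isometry ha ha0
  obtain ⟨ρ', hρ'⟩ : ∃ ρ' : ℝ≥0, (ρ' : ℝ) = 2 * ρ := ⟨⟨2 * ρ, by positivity⟩, rfl⟩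
  set T := firstTime o α ρ with hT
  -- `α` is left where it is nearest to the part of `a` beyond `2 * ρ`, along a shortest bridge of
  -- length `δ`. Minimality (`hδle`) keeps the new path from backtracking.
  obtain ⟨τ, hτ, hmin⟩ := (isCompact_Icc (a := 0) (b := T)).exists_isMinOn ⟨0, by simp⟩
    ((Metric.continuous_infDist_pt (a '' Ici ρ')).comp hα.continuous).continuousOn
  obtain ⟨S, hS, hSd⟩ := haq.exists_infDist_image_eq (isClosed_Ici (a := ρ')) ⟨ρ', self_mem_Ici⟩
    (α τ)
  have hS' : 2 * ρ ≤ S := hρ' ▸ NNReal.coe_le_coe.2 hS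
  obtain ⟨δ, hδ⟩ : ∃ δ : ℝ≥0, (δ : ℝ) = dist (α τ) (a S) := ⟨⟨_, dist_nonneg⟩, rfl⟩
  have hδle : ∀ t ≤ T, ∀ w ∈ Ici ρ', (δ : ℝ) ≤ dist (α t) (a w) := fun t ht w hw => by
    have h1 : Metric.infDist (α τ) (a '' Ici ρ') ≤ Metric.infDist (α t) (a '' Ici ρ') :=
      hmin (show t ∈ Icc 0 T from ⟨zero_le, ht⟩)
    rw [hδ, ← hSd]
    exact h1.trans (Metric.infDist_le_dist_of_mem (mem_image_of_mem a hw))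
  -- Going through `a z` gives `δ ≤ ρ / 4 + 5 * ρ / 4`, while the bridge ends at norm `S ≥ 2 * ρ`.
  have hτρ : ρ / 2 ≤ dist o (α τ) := by
    obtain ⟨z, -, hz⟩ := haq.exists_infDist_image_eq isClosed_univ univ_nonempty (α T)
    rw [image_univ] at hz
    rw [hz] at hclose
    have h1 := hδle T le_rfl ρ' self_mem_Ici
    have h2 : |(z : ℝ) - ρ| ≤ dist (α T) (a z) := by
      have h3 := hα.dist_firstTime hρ.le
      rw [← hT] at h3
      rw [← dist_isometry ha ha0 z, ← h3, dist_comm (α T), dist_comm o, dist_comm o]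
      exact abs_dist_sub_le _ _ _
    have h3 : dist (a z) (a ρ') = |(z : ℝ) - 2 * ρ| := by rw [ha.dist_eq, NNReal.dist_eq, hρ']
    have h4 := abs_le.1 (h2.trans hclose)
    have h5 : |(z : ℝ) - 2 * ρ| ≤ ρ + ρ / 4 := abs_le.2 ⟨by linarith, by linarith⟩
    have h6 := dist_triangle (α T) (a z) (a ρ')
    have h7 := dist_triangle o (α τ) (a S)
    rw [dist_isometry ha ha0] at h7
    linarith
  obtain ⟨σ, hσ⟩ := hX.geodesic (α τ) (a S)
  rw [IsGeodesicSegment, ← hδ] at hσ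
  obtain ⟨hσ0, hσδ, hσd⟩ := hσ
  have hσd' : ∀ e e' : ℝ≥0, e ≤ e' → e' ≤ δ → dist (σ e) (σ e') = e' - e := fun e e' h h' => by
    have h1 : (e : ℝ) ≤ e' := NNReal.coe_le_coe.2 h
    have h2 : (e' : ℝ) ≤ δ := NNReal.coe_le_coe.2 h'
    rw [hσd e ⟨e.coe_nonneg, h1.trans h2⟩ e' ⟨e'.coe_nonneg, h2⟩, abs_sub_comm,
      abs_of_nonneg (sub_nonneg.2 h1)]
  set s₁ : ℝ≥0 → X := fun t => σ (min t δ) with hs₁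
  set g := concatPath s₁ δ (fun t => a (S + t)) with hg
  set η := concatPath α τ g with hη
  have hglue : s₁ δ = (fun t => a (S + t)) 0 := by simp [hs₁, hσδ]
  have hglue' : α τ = g 0 := by simp [hg, concatPath_of_le, hs₁, hσ0]
  have hη₁ : ∀ t ≤ τ, η t = α t := fun t ht => concatPath_of_le ht
  have hη₂ : ∀ e ≤ δ, η (τ + e) = σ e := fun e he => by
    rw [hη, concatPath_add hglue', hg, concatPath_of_le he]
    simp [hs₁, min_eq_left (NNReal.coe_le_coe.2 he)]
  have hη₃ : ∀ e, η (τ + δ + e) = a (S + e) := fun e => by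
    rw [hη, add_assoc, concatPath_add hglue', hg, concatPath_add hglue]
  have hs₁c : Continuous s₁ := by
    have := (show IsGeodesicSegment σ (α τ) (a S) from
      ⟨hσ0, by rw [← hδ, hσδ], by rwa [← hδ]⟩).lipschitzWith.continuous
    rwa [← hδ] at this
  have hηc : Continuous η := continuous_concatPath hα.continuous
    (continuous_concatPath hs₁c (ha.continuous.comp (continuous_const.add continuous_id)) hglue)
    hglue'
  have had : ∀ w w' : ℝ≥0, w ≤ w' → dist (a w) (a w') = w' - w := fun w w' h => by
    rw [ha.dist_eq, NNReal.dist_eq, abs_sub_comm, abs_of_nonneg (sub_nonneg.2 (NNReal.coe_le_coe.2 h))]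
  have hcases : ∀ t, t ≤ τ ∨ (∃ e ≤ δ, t = τ + e) ∨ ∃ e, t = τ + δ + e := fun t => by
    rcases le_total t τ with h | h
    · exact Or.inl h
    obtain ⟨e, rfl⟩ := exists_add_of_le h
    rcases le_total e δ with h' | h'
    · exact Or.inr (Or.inl ⟨e, h', rfl⟩)
    · obtain ⟨e', rfl⟩ := exists_add_of_le h'
      exact Or.inr (Or.inr ⟨e', (add_assoc _ _ _).symm⟩)
  have hσ0' : ∀ e ≤ δ, dist (α τ) (σ e) = e := fun e he => by
    have := hσd' 0 e zero_le he
    rwa [NNReal.coe_zero, hσ0, sub_zero] at this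
  have hσδ' : ∀ e ≤ δ, dist (σ e) (a S) = δ - e := fun e he => by
    have := hσd' e δ he le_rfl
    rwa [hσδ] at this
  have hd : ∀ s t : ℝ≥0, s ≤ t → dist s t = t - s := fun s t h => by
    rw [NNReal.dist_eq, abs_sub_comm, abs_of_nonneg (sub_nonneg.2 (NNReal.coe_le_coe.2 h))]
  have hKK : K ≤ K * K := by nlinarith
  have hfirst : ∀ s ≤ τ, ∀ {E D : ℝ}, 0 ≤ E → dist (α s) (α τ) ≤ 2 * D → E ≤ 2 * D → 0 ≤ D →
      D ≤ dist (α s) (α τ) + E → (τ : ℝ) + E - s ≤ 4 * K * (D + 4 * K) ∧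
        D ≤ 4 * K * (τ + E - s) + 4 * K := by
    intro s hs E D hE h1 h2 hD h3
    have h4 := hα.dist_le_mul s τ
    have h5 := hα.upper s τ
    rw [hd s τ hs] at h4 h5
    have h6 := mul_le_mul_of_nonneg_left h1 (zero_le_one.trans hK)
    have h7 : (s : ℝ) ≤ τ := NNReal.coe_le_coe.2 hs
    have h8 : 0 ≤ K * (τ - s) := mul_nonneg (by linarith) (by linarith)
    have h9 : E ≤ K * E := le_mul_of_one_le_left hE hK
    have h10 : D ≤ K * D := le_mul_of_one_le_left hD hK
    constructor
    · linarith
    · linarith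
  have main : ∀ s t : ℝ≥0, s ≤ t → (t : ℝ) - s ≤ 4 * K * (dist (η s) (η t) + 4 * K) ∧
      dist (η s) (η t) ≤ 4 * K * (t - s) + 4 * K := by
    intro s t hst
    rcases hst.eq_or_lt with rfl | hlt
    · simp only [sub_self, dist_self, mul_zero]
      constructor <;> positivity
    have hst' : (s : ℝ) ≤ t := NNReal.coe_le_coe.2 hst
    have hlip : ∀ {D L : ℝ}, 0 ≤ D → 0 ≤ L → L ≤ 3 * D → D ≤ L →
        L ≤ 4 * K * (D + 4 * K) ∧ D ≤ 4 * K * L + 4 * K := fun {D L} hD hL h1 h2 =>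
      ⟨by nlinarith, by nlinarith⟩
    rcases hcases s with hs | ⟨e, he, rfl⟩ | ⟨e, rfl⟩ <;>
      rcases hcases t with ht | ⟨e', he', rfl⟩ | ⟨e', rfl⟩
    · have h1 := hα.dist_le_mul s t
      have h2 := hα.upper s t
      rw [hd s t hst] at h1 h2
      rw [hη₁ s hs, hη₁ t ht]
      have h3 : 0 ≤ K * dist (α s) (α t) := by positivity
      have h4 : 0 ≤ K * (t - s) := mul_nonneg (by linarith) (by linarith)
      constructor <;> linarith
    · rw [hη₁ s hs, hη₂ e' he', NNReal.coe_add]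
      have h1 := hδle s (hs.trans hτ.2) S hS
      have h2 := dist_triangle (α s) (σ e') (a S)
      have h3 := dist_triangle_right (α s) (α τ) (σ e')
      have h4 := dist_triangle (α s) (α τ) (σ e')
      rw [hσδ' e' he'] at h2
      rw [hσ0' e' he'] at h3 h4
      exact hfirst s hs e'.coe_nonneg (by linarith) (by linarith) dist_nonneg h4
    · rw [hη₁ s hs, hη₃ e', NNReal.coe_add, NNReal.coe_add, add_assoc]
      -- `α s` and `α τ` lie in the `ρ`-ball and the tail of `a` beyond radius `2 * ρ`, so the
      -- distance is at least `ρ + e'`; minimality bounds `δ`.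
      have h1 := hδle s (hs.trans hτ.2) (S + e') (le_trans (mem_Ici.1 hS) (le_add_of_nonneg_right zero_le))
      have h2 := hα.dist_le_of_le_firstTime hρ.le (hs.trans hτ.2)
      have h3 := hα.dist_le_of_le_firstTime hρ.le hτ.2
      have h4 := dist_triangle o (α s) (a (S + e'))
      rw [dist_isometry ha ha0, NNReal.coe_add] at h4
      have h5 := dist_triangle_left (α s) (α τ) o
      have h6 := dist_triangle4 (α s) (α τ) (a S) (a (S + e'))
      rw [had S (S + e') (le_add_of_nonneg_right zero_le), ← hδ, NNReal.coe_add] at h6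
      have := e'.coe_nonneg
      have := δ.coe_nonneg
      exact hfirst s hs (by positivity) (by linarith) (by linarith) dist_nonneg (by linarith)
    · exact absurd hlt (not_lt.2 (ht.trans (le_add_of_nonneg_right zero_le)))
    · rw [hη₂ e he, hη₂ e' he', hσd' e e' (le_of_add_le_add_left hst) he', NNReal.coe_add,
        NNReal.coe_add]
      rw [NNReal.coe_add, NNReal.coe_add] at hst'
      exact hlip (by linarith) (by linarith) (by linarith) (by linarith)
    · rw [hη₂ e he, hη₃ e', NNReal.coe_add, NNReal.coe_add, NNReal.coe_add]
      have h1 := hδle τ hτ.2 (S + e') (le_trans (mem_Ici.1 hS) (le_add_of_nonneg_right zero_le))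
      have h2 := dist_triangle (α τ) (σ e) (a (S + e'))
      have h3 := dist_triangle (σ e) (a S) (a (S + e'))
      have h4 := dist_triangle_left (a S) (a (S + e')) (σ e)
      rw [had S (S + e') (le_add_of_nonneg_right zero_le), NNReal.coe_add, hσδ' e he] at h3 h4
      rw [hσ0' e he] at h2
      have h5 : (e : ℝ) ≤ δ := NNReal.coe_le_coe.2 he
      have := e'.coe_nonneg
      exact hlip dist_nonneg (by linarith) (by linarith) (by linarith)
    · exact absurd hlt (not_lt.2 ((ht.trans (le_add_of_nonneg_right zero_le)).trans
        (le_add_of_nonneg_right zero_le)))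
    · exact absurd hlt (not_lt.2 ((add_le_add_right he' τ).trans
        (le_add_of_nonneg_right zero_le)))
    · rw [hη₃, hη₃, had _ _ (add_le_add_right (le_of_add_le_add_left hst) S)]
      simp only [NNReal.coe_add] at hst' ⊢
      exact hlip (by linarith) (by linarith) (by linarith) (by linarith)
  have hlower : ∀ s t : ℝ≥0, dist s t ≤ 4 * K * (dist (η s) (η t) + 4 * K) := fun s t => by
    rcases le_total s t with h | h
    · rw [hd s t h]; exact (main s t h).1
    · rw [dist_comm, hd t s h, dist_comm (η s)]; exact (main t s h).1
  refine ⟨η, ⟨by linarith, by linarith, hηc, by rw [hη₁ 0 zero_le, hα.start], fun s t => ?_,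
    fun s t => ?_⟩, ⟨τ + δ, S, hη₃⟩, τ, hτρ, hη₁⟩
  · rw [sub_le_iff_le_add, div_mul_eq_mul_div, one_mul, div_le_iff₀ (by linarith), mul_comm]
    exact hlower s t
  · rcases le_total s t with h | h
    · rw [hd s t h]; exact (main s t h).2
    · rw [dist_comm s, hd t s h, dist_comm (η s)]; exact (main t s h).2

/-! ### The visual topology -/

theorem exists_subset_kappaNeighborhood_of_eventuallyEq (κ : SublinearFunction)
    {β γ : QuasiGeodesicRay o} {T S : ℝ≥0} (h : ∀ t, β.1 (T + t) = γ.1 (S + t)) :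
    ∃ n, range β.1 ⊆ kappaNeighborhood κ o (range γ.1) n := by
  obtain ⟨q, Q, hβ⟩ := β.2
  have hq := one_pos.trans_le hβ.one_le
  have hQ := hβ.nonneg
  refine ⟨q * T + Q, ?_⟩
  rintro _ ⟨t, rfl⟩
  have hk := κ.one_le (dist o (β.1 t)) dist_nonneg
  have hn : 0 ≤ q * (T : ℝ) + Q := by positivity
  rcases le_total t T with ht | ht
  · have h1 := hβ.upper 0 t
    rw [hβ.start, NNReal.dist_eq, NNReal.coe_zero, zero_sub, abs_neg,
      abs_of_nonneg t.coe_nonneg] at h1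
    have h2 : q * (t : ℝ) ≤ q * T := mul_le_mul_of_nonneg_left (NNReal.coe_le_coe.2 ht) hq.le
    have h3 := Metric.infDist_le_dist_of_mem (x := β.1 t) γ.mem_range
    rw [dist_comm] at h3
    exact (h3.trans (h1.trans (by linarith))).trans (le_mul_of_one_le_right hn hk)
  · obtain ⟨e, rfl⟩ := exists_add_of_le ht
    have h1 : β.1 (T + e) ∈ range γ.1 := ⟨S + e, (h e).symm⟩
    exact (Metric.infDist_zero_of_mem h1).trans_le (by positivity)

theorem FellowTravel.of_eventuallyEq (κ : SublinearFunction) {β γ : QuasiGeodesicRay o} {T S : ℝ≥0}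
    (h : ∀ t, β.1 (T + t) = γ.1 (S + t)) : FellowTravel κ β γ :=
  ⟨exists_subset_kappaNeighborhood_of_eventuallyEq κ h,
    exists_subset_kappaNeighborhood_of_eventuallyEq κ fun t => (h t).symm⟩

theorem IsMorseGauge.isQuasiGeodesicRay {κ : SublinearFunction} {Z : Set X} {m : ℝ → ℝ → ℝ}
    (hm : IsMorseGauge κ o Z m) {q Q r : ℝ} {α : ℝ≥0 → X} (hα : IsQuasiGeodesicRay o q Q α)
    (h : SmallComparedTo κ (m q Q) r) :
    IsQuasiGeodesicRay o (max 1 (r / (2 * κ r))) (max 1 (r / (2 * κ r))) α := by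
  have h1 := ((hm.1 q Q hα.one_le hα.nonneg).trans h).trans (le_max_right 1 _)
  exact hα.mono ((le_max_left q Q).trans h1) ((le_max_right q Q).trans h1)

/-- Neighbourhoods of a geodesic ray with respect to different gauges are comparable. -/
theorem IsMorseGauge.exists_initialPart_subset {κ κ' : SublinearFunction} {b : ℝ≥0 → X}
    {m' : ℝ → ℝ → ℝ} (hm' : IsMorseGauge κ' o (range b) m') (m : ℝ → ℝ → ℝ) {r : ℝ} (hr : 0 < r) :
    ∃ r', 0 < r' ∧ ∀ α : ℝ≥0 → X,
      (∀ q Q, IsQuasiGeodesicRay o q Q α → SmallComparedTo κ (m q Q) r' →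
        initialPart o α r' ⊆ kappaNeighborhood κ o (range b) (m q Q)) →
      ∀ q Q, IsQuasiGeodesicRay o q Q α → SmallComparedTo κ' (m' q Q) r →
        initialPart o α r ⊆ kappaNeighborhood κ' o (range b) (m' q Q) := by
  -- Every admissible ray is a `(C, C)`-quasi-geodesic, so its closeness to `b` at radius `R` has
  -- the uniform constant `m C C`.
  set C := max 1 (r / (2 * κ' r))
  obtain ⟨R, hR, h⟩ := hm'.2 r hr (max (m C C) 1) (lt_max_of_lt_right one_pos) κ
  obtain ⟨r', hsmall, hr'⟩ :=
    ((eventually_smallComparedTo κ (m C C)).and (eventually_ge_atTop R)).exists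
  refine ⟨r', hR.trans_le hr', fun α hα q Q hqQ hq => h q Q α hqQ hq ?_⟩
  have h1 := hα C C (hm'.isQuasiGeodesicRay hqQ hq) hsmall (hqQ.mem_initialPart hR.le hr')
  have h2 := kappaNeighborhood_mono κ (le_max_left (m C C) 1) h1
  simpa only [kappaNeighborhood, mem_ofPred_eq, hqQ.dist_firstTime hR.le] using h2

theorem fellowTravel_of_mem {κ : SublinearFunction} {A : Set (QuasiGeodesicRay o)}
    (hA : A ∈ morseBoundary κ o) {a α : QuasiGeodesicRay o} (ha : a ∈ A) (hα : α ∈ A) :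
    FellowTravel κ a α := by
  obtain ⟨β, -, rfl⟩ := hA
  exact FellowTravel.trans (FellowTravel.symm ha) hα

theorem mem_of_fellowTravel {κ : SublinearFunction} {A : Set (QuasiGeodesicRay o)}
    (hA : A ∈ morseBoundary κ o) {a α : QuasiGeodesicRay o} (ha : a ∈ A)
    (h : FellowTravel κ a α) : α ∈ A := by
  obtain ⟨β, -, rfl⟩ := hA
  exact FellowTravel.trans ha h

theorem mem_basicNeighborhood {κ : SublinearFunction} {A : morseBoundary κ o}
    {a : QuasiGeodesicRay o} (ha : a ∈ A.1) {m : ℝ → ℝ → ℝ} (hm : IsMorseGauge κ o (range a.1) m)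
    {r : ℝ} (hr : 0 < r) : A ∈ basicNeighborhood κ o a.1 m r := by
  intro α hα q Q hq hsmall
  obtain ⟨n, hn⟩ := (fellowTravel_of_mem A.2 ha hα).2
  obtain ⟨R, hR, h⟩ := hm.2 r hr (max n 1) (lt_max_of_lt_right one_pos) κ
  refine h q Q α.1 hq hsmall ?_
  have := hn.trans (kappaNeighborhood_mono κ (le_max_left n 1))
    (mem_range_self (firstTime o α.1 R))
  simpa only [kappaNeighborhood, mem_ofPred_eq, hq.dist_firstTime hR.le] using this

theorem IsContracting.exists_isMorseGauge_range [ProperSpace X] {κ : SublinearFunction}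
    {β : QuasiGeodesicRay o} (h : IsContracting κ o (range β.1)) :
    ∃ m, IsMorseGauge κ o (range β.1) m :=
  h.exists_isMorseGauge β.nearestPoints_nonempty β.mem_range

/-- Every boundary point is represented by a geodesic ray with a Morse gauge. -/
theorem exists_mem_isometry_isMorseGauge [ProperSpace X] (hX : IsCAT0 X) {κ : SublinearFunction}
    {A : Set (QuasiGeodesicRay o)} (hA : A ∈ morseBoundary κ o) :
    ∃ a ∈ A, Isometry a.1 ∧ ∃ m, IsMorseGauge κ o (range a.1) m := by
  obtain ⟨β, hβ, rfl⟩ := hA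
  obtain ⟨b, hb, hβb⟩ := hβ.exists_isometry_fellowTravel hX
  obtain ⟨m, hm⟩ := hβ.exists_isMorseGauge_range
  exact ⟨b, hβb, hb, hm.of_subset (range_nonempty _) (range_nonempty _) hβb.1 hβb.2⟩

/-- Each point of a smaller neighbourhood of `b` has all of its own small neighbourhoods inside a
given neighbourhood of `b`. -/
theorem IsMorseGauge.exists_basicNeighborhood_subset [ProperSpace X] (hX : IsCAT0 X)
    {κ : SublinearFunction} {b : ℝ≥0 → X} {m : ℝ → ℝ → ℝ} (hm : IsMorseGauge κ o (range b) m)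
    {r : ℝ} (hr : 0 < r) :
    ∃ r', 0 < r' ∧ ∀ A ∈ basicNeighborhood κ o b m r', ∀ a ∈ A.1, Isometry a.1 →
      ∀ mₐ : ℝ → ℝ → ℝ, ∃ r'', 0 < r'' ∧
        basicNeighborhood κ o a.1 mₐ r'' ⊆ basicNeighborhood κ o b m r := by
  set C := max 1 (r / (2 * κ r))
  -- Surgery multiplies the constants by `4`.
  set n := m (4 * C) (4 * C)
  obtain ⟨R, hR, h⟩ := hm.2 r hr (max n 1) (lt_max_of_lt_right one_pos) κ
  obtain ⟨r', hsmall, hr'⟩ :=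
    ((eventually_smallComparedTo κ n).and (eventually_ge_atTop R)).exists
  have hr'0 : 0 < r' := hR.trans_le hr'
  refine ⟨r', hr'0, fun A hA a ha haiso mₐ => ?_⟩
  -- Smallness of `2 * mₐ C C` gives the distance `ρ / 4` required for surgery, and `ρ ≥ 2 * r'`
  -- keeps `α` unchanged until it has passed radius `R`.
  obtain ⟨ρ, hρ, hρ', hρr⟩ := ((eventually_smallComparedTo κ (mₐ C C)).and
    ((eventually_smallComparedTo κ (2 * mₐ C C)).and (eventually_ge_atTop (2 * r')))).exists
  have hρ0 : 0 < ρ := by linarith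
  refine ⟨ρ, hρ0, fun A' hA' α hα q Q hq hqs => h q Q α.1 hq hqs ?_⟩
  have hαC := hm.isQuasiGeodesicRay hq hqs
  have h1 : Metric.infDist (α.1 (firstTime o α.1 ρ)) (range a.1) ≤ ρ / 4 := by
    have h2 : Metric.infDist (α.1 (firstTime o α.1 ρ)) (range a.1) ≤
        mₐ C C * κ (dist o (α.1 (firstTime o α.1 ρ))) := hA' α hα C C hαC hρ (hq.mem_initialPart hρ0.le le_rfl)
    rw [hq.dist_firstTime hρ0.le] at h2
    have hk := κ.pos hρ0.le
    rw [SmallComparedTo, le_div_iff₀ (by positivity)] at hρ'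
    linarith
  obtain ⟨η, hη, ⟨T, S, hTS⟩, τ, hτ, hητ⟩ := hαC.exists_surgery hX haiso a.start hρ0 h1
  have hηA : (⟨η, _, _, hη⟩ : QuasiGeodesicRay o) ∈ A.1 :=
    mem_of_fellowTravel A.2 ha (FellowTravel.of_eventuallyEq κ hTS).symm
  have htτ : firstTime o α.1 R ≤ τ := hq.firstTime_le hR.le (by linarith)
  have hmem : α.1 (firstTime o α.1 R) ∈ initialPart o η r' := by
    rw [← hητ _ htτ]
    refine mem_image_of_mem η (mem_Iic.2 ?_)
    -- If `η` reaches norm `r'` before the surgery, it still equals `α` there, and `α` has already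
    -- passed `R ≤ r'`.
    rcases le_total (firstTime o η r') τ with hle | hle
    · refine hq.firstTime_le hR.le ?_
      rwa [← hητ _ hle, hη.dist_firstTime hr'0.le]
    · exact htτ.trans hle
  have h3 := kappaNeighborhood_mono κ (le_max_left n 1) (hA _ hηA _ _ hη hsmall hmem)
  simpa only [kappaNeighborhood, mem_ofPred_eq, hq.dist_firstTime hR.le] using h3

/-- The interior of a set of boundary points. -/
def visualInterior (κ : SublinearFunction) (o : X) (V : Set (morseBoundary κ o)) :
    Set (morseBoundary κ o) :=
  {A | ∀ a ∈ A.1, Isometry a.1 → ∀ m : ℝ → ℝ → ℝ, IsMorseGauge κ o (range a.1) m →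
    ∃ r : ℝ, 0 < r ∧ basicNeighborhood κ o a.1 m r ⊆ V}

theorem isOpen_visualInterior [ProperSpace X] (hX : IsCAT0 X) (κ : SublinearFunction)
    (V : Set (morseBoundary κ o)) : IsOpen[visualTopology κ o] (visualInterior κ o V) := by
  intro A hA a ha haiso m hm
  obtain ⟨r, hr, hV⟩ := hA a ha haiso m hm
  obtain ⟨r', hr', h⟩ := hm.exists_basicNeighborhood_subset hX hr
  refine ⟨r', hr', fun A' hA' a' ha' haiso' m' _ => ?_⟩
  obtain ⟨r'', hr'', h'⟩ := h A' hA' a' ha' haiso' m'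
  exact ⟨r'', hr'', h'.trans hV⟩

theorem visualInterior_subset [ProperSpace X] (hX : IsCAT0 X) (κ : SublinearFunction)
    (V : Set (morseBoundary κ o)) : visualInterior κ o V ⊆ V := by
  intro A hA
  obtain ⟨a, ha, haiso, m, hm⟩ := exists_mem_isometry_isMorseGauge hX A.2
  obtain ⟨r, hr, hV⟩ := hA a ha haiso m hm
  exact hV (mem_basicNeighborhood ha hm hr)

theorem mem_visualInterior_basicNeighborhood [ProperSpace X] (hX : IsCAT0 X)
    {κ : SublinearFunction} {B : morseBoundary κ o} {b : QuasiGeodesicRay o} (hb : b ∈ B.1)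
    {m : ℝ → ℝ → ℝ} (hm : IsMorseGauge κ o (range b.1) m) {r : ℝ} (hr : 0 < r) :
    B ∈ visualInterior κ o (basicNeighborhood κ o b.1 m r) := by
  obtain ⟨r', hr', h⟩ := hm.exists_basicNeighborhood_subset hX hr
  intro b' hb' hiso m' _
  exact h B (mem_basicNeighborhood hb hm hr') b' hb' hiso m'

theorem visualInterior_mono (κ : SublinearFunction) {V W : Set (morseBoundary κ o)} (h : V ⊆ W) :
    visualInterior κ o V ⊆ visualInterior κ o W := fun _ hA a ha haiso m hm =>
  let ⟨r, hr, hV⟩ := hA a ha haiso m hm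
  ⟨r, hr, hV.trans h⟩

/-! ### Comparison of the boundaries for two sublinear functions -/

theorem IsContracting.of_le {κ κ' : SublinearFunction} {M : ℝ}
    (h : ∀ t, 0 ≤ t → κ' t ≤ M * κ t) {Z : Set X} (hZ : IsContracting κ' o Z) :
    IsContracting κ o Z := by
  obtain ⟨c, hc⟩ := hZ
  refine ⟨max c 0 * M, fun x y hxy u hu v hv => (hc x y hxy u hu v hv).trans ?_⟩
  rw [mul_assoc]
  exact (mul_le_mul_of_nonneg_right (le_max_left c 0) (κ'.pos dist_nonneg).le).trans
    (mul_le_mul_of_nonneg_left (h _ dist_nonneg) (le_max_right _ _))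

theorem morseBoundary_subset [ProperSpace X] {κ κ' : SublinearFunction} {M : ℝ}
    (h : ∀ t, 0 ≤ t → κ' t ≤ M * κ t) : morseBoundary κ' o ⊆ morseBoundary κ o := by
  rintro _ ⟨β, hβ, rfl⟩
  obtain ⟨m, hm⟩ := hβ.exists_isMorseGauge_range
  exact ⟨β, hβ.of_le h, Set.ext fun γ => ⟨fun hγ => FellowTravel.of_le h hγ,
    fun hγ => hm.fellowTravel hγ⟩⟩

theorem visualTopology_eq_induced [ProperSpace X] (hX : IsCAT0 X) {κ κ' : SublinearFunction}
    {M : ℝ} (hM : 1 ≤ M) (h : ∀ t, 0 ≤ t → κ' t ≤ M * κ t) :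
    visualTopology κ' o =
      (visualTopology κ o).induced (Set.inclusion (morseBoundary_subset (o := o) h)) := by
  refine TopologicalSpace.ext_iff.2 fun W' => ?_
  change IsOpen[visualTopology κ' o] W' ↔ ∃ W, IsOpen[visualTopology κ o] W ∧
    Set.inclusion (morseBoundary_subset h) ⁻¹' W = W'
  constructor
  · intro hW'
    -- `V` is the largest set with trace `W'`. Its interior loses no point of `W'`, by the
    -- comparison of neighbourhoods.
    set V : Set (morseBoundary κ o) := {A | ∀ hA : A.1 ∈ morseBoundary κ' o, ⟨A.1, hA⟩ ∈ W'}
    refine ⟨visualInterior κ o V, isOpen_visualInterior hX κ V, Subset.antisymm (fun A hA => ?_)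
      fun B hB => ?_⟩
    · exact visualInterior_subset hX κ V hA A.2
    · obtain ⟨b, hb, hbiso, m', hm'⟩ := exists_mem_isometry_isMorseGauge hX B.2
      obtain ⟨r, hr, hrW⟩ := hW' B hB b hb hbiso m' hm'
      obtain ⟨r', hr', hcomp⟩ := hm'.exists_initialPart_subset (κ := κ) (fun q Q => M * m' q Q) hr
      refine visualInterior_mono κ ?_ (mem_visualInterior_basicNeighborhood hX
        (B := Set.inclusion (morseBoundary_subset h) B) hb (hm'.of_le hM h) hr')
      exact fun A hA hA' => hrW fun α hα => hcomp α.1 (hA α hα)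
  · rintro ⟨W, hW, rfl⟩ B hB b hb hbiso m' hm'
    obtain ⟨r, hr, hrW⟩ := hW _ hB b hb hbiso _ (hm'.of_le hM h)
    obtain ⟨r', hr', hcomp⟩ :=
      (hm'.of_le hM h).exists_initialPart_subset (κ := κ') m' hr
    exact ⟨r', hr', fun A hA => hrW fun α hα => hcomp α.1 (hA α hα)⟩

end SublinearlyMorse

theorem proposition4p9 {X : Type*} [MetricSpace X] [ProperSpace X] (hX : IsCAT0 X) (o : X)
    (κ κ' : SublinearFunction) (M : ℝ) (hM : 0 < M) (hκ : ∀ t : ℝ, 0 < t → κ' t ≤ M * κ t) :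
    ∃ hsub : morseBoundary κ' o ⊆ morseBoundary κ o,
      visualTopology κ' o = (visualTopology κ o).induced (Set.inclusion hsub) := by
  -- The bound is assumed only for `t > 0`; the value at `0` is covered by `κ' 0`, as `κ 0 ≥ 1`. The
  -- `1` is needed for `IsMorseGauge.of_le`.
  have h : ∀ t, 0 ≤ t → κ' t ≤ max 1 (max M (κ' 0)) * κ t := fun t ht => by
    have h1 := κ.one_le t ht
    rcases ht.eq_or_lt with rfl | ht'
    · exact ((le_max_right M _).trans (le_max_right 1 _)).trans
        (le_mul_of_one_le_right (zero_le_one.trans (le_max_left _ _)) h1)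
    · exact (hκ t ht').trans (mul_le_mul_of_nonneg_right
        ((le_max_left M _).trans (le_max_right 1 _)) (zero_le_one.trans h1))
  exact ⟨morseBoundary_subset h, visualTopology_eq_induced hX (le_max_left _ _) h⟩
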